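/- Let $K$ be a perfect field with algebraic closure $\overline{K}$ and $G_K=\operatorname{Gal}(\overline{K}/K)$, let $N$ be a positive integer not divisible by the characteristic of $K$, and let $E$ be an elliptic curve over $K$. Then $E[N]\subset E(\overline{K})$ is a free $\mathbb{Z}/N\mathbb{Z}$-module of rank $2$. Fix any basis of $E[N]$, and let $\overline{\rho}_{E,N} : G_K \to \operatorname{GL}_2(\mathbb{Z}/N\mathbb{Z})$ be the representation giving the action of $G_K$ on $E[N]$ with respect to this basis. Let $\chi_N : G_K \to (\mathbb{Z}/N\mathbb{Z})^*$ be the mod $N$ cyclotomic character, defined by $\sigma(\zeta)=\zeta^{\chi_N(\sigma)}$ for all $N$-th roots of unity $\zeta\in\overline{K}$. The following are equivalent: (a) $E$ has a $K$-rational point of exact order $N$; (b) $\overline{\rho}_{E,N} \sim \begin{pmatrix} 1 & * \\ 0 & \chi_N \end{pmatrix}$, that is, there are $g\in \operatorname{GL}_2(\mathbb{Z}/N\mathbb{Z})$ and a function $\beta : G_K\to \mathbb{Z}/N\mathbb{Z}$ such that $g\,\overline{\rho}_{E,N}(\sigma)\,g^{-1} = \begin{pmatrix} 1 & \beta(\sigma)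 \\ 0 & \chi_N(\sigma) \end{pmatrix}$ for all $\sigma\in G_K$; (c) $\overline{\rho}_{E,N}(G_K)$ is conjugate inside $\operatorname{GL}_2(\mathbb{Z}/N\mathbb{Z})$ to a subgroup of $$B_1(N) = \left\{ \begin{pmatrix} 1 & b \\ 0 & d \end{pmatrix} : b\in\mathbb{Z}/N\mathbb{Z},\ d\in(\mathbb{Z}/N\mathbb{Z})^* \right\}\subset \operatorname{GL}_2(\mathbb{Z}/N\mathbb{Z}).$$ -/

import Mathlib

open scoped MatrixGroups WeierstrassCurve.Affine

namespace ModNGalois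

noncomputable section

variable {K : Type*} [Field K]

/-- The group `E(K̄)` of points of `E` over the algebraic closure of `K`. -/
abbrev GeomPoint (E : WeierstrassCurve K) : Type _ :=
  (E⁄(AlgebraicClosure K)).Point

/-- The `N`-torsion subgroup `E[N]` of `E(K̄)`. -/
abbrev Torsion [DecidableEq (AlgebraicClosure K)] (E : WeierstrassCurve K) (N : ℕ) :
    AddSubgroup (GeomPoint E) :=
  AddSubgroup.torsionBy (GeomPoint E) (N : ℤ)

/-- `E[N]` is a `ℤ/Nℤ`-module, with `(a mod N) • P = a • P`. -/
instance torsionModule [DecidableEq (AlgebraicClosure K)] (E : WeierstrassCurve K) (N : ℕ) :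
    Module (ZMod N) (Torsion E N) :=
  AddSubgroup.torsionBy.zmodModule

/-- The additive map `E[N] → E[N]`, `P ↦ σ(P)`, for `σ` in the absolute Galois group of `K`. -/
def galoisAddHom [DecidableEq (AlgebraicClosure K)] (E : WeierstrassCurve K) (N : ℕ)
    (σ : Gal(AlgebraicClosure K/K)) : Torsion E N →+ Torsion E N :=
  ((WeierstrassCurve.Affine.Point.map (W' := E) (σ : AlgebraicClosure K →ₐ[K] AlgebraicClosure K)).comp
    (Torsion E N).subtype).codRestrict (Torsion E N) fun P ↦ by
      rw [AddSubgroup.torsionBy.nsmul_iff, AddMonoidHom.comp_apply, ← map_nsmul, ← map_nsmul,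
        AddSubgroup.torsionBy.nsmul, map_zero, map_zero]

/-- The mod `N` Galois representation of `E`, as an action by `ℤ/Nℤ`-linear endomorphisms;
its values are automorphisms, since it is a monoid homomorphism from a group. -/
def galoisEnd [DecidableEq (AlgebraicClosure K)] (E : WeierstrassCurve K) (N : ℕ) :
    Gal(AlgebraicClosure K/K) →* Module.End (ZMod N) (Torsion E N) where
  toFun σ := (galoisAddHom E N σ).toZModLinearMap N
  map_one' := by
    ext P
    rcases P with ⟨P | ⟨x, y, h⟩, hP⟩ <;> rfl
  map_mul' σ τ := by
    ext P
    rcases P with ⟨P | ⟨x, y, h⟩, hP⟩ <;> rfl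

/-- The mod `N` Galois representation `ρ̄_{E,N} : G_K → Aut(E[N])`. -/
def galoisRep [DecidableEq (AlgebraicClosure K)] (E : WeierstrassCurve K) (N : ℕ) :
    Gal(AlgebraicClosure K/K) →* LinearMap.GeneralLinearGroup (ZMod N) (Torsion E N) :=
  (galoisEnd E N).toHomUnits

/-- The matrix form `ρ̄_{E,N} : G_K → GL₂(ℤ/Nℤ)` with respect to a basis `b` of `E[N]`;
the `j`-th column of the matrix of `σ` holds the coordinates of `σ(b j)`. -/
def matrixRep [DecidableEq (AlgebraicClosure K)] (E : WeierstrassCurve K) (N : ℕ)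
    (b : Module.Basis (Fin 2) (ZMod N) (Torsion E N)) :
    Gal(AlgebraicClosure K/K) →* GL (Fin 2) (ZMod N) :=
  (Units.map (LinearMap.toMatrixAlgEquiv b : _ →* Matrix (Fin 2) (Fin 2) (ZMod N))).comp
    (galoisRep E N)

variable (K) in
/-- The mod `N` cyclotomic character `χ_N : G_K → (ℤ/Nℤ)ˣ`, characterised by
`σ(ζ) = ζ ^ χ_N(σ)` for every `N`-th root of unity `ζ` in `K̄`. -/
def cyclotomicChar (N : ℕ) [NeZero N] [NeZero (N : K)] :
    Gal(AlgebraicClosure K/K) →* (ZMod N)ˣ :=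
  (modularCyclotomicCharacter (AlgebraicClosure K)
      (HasEnoughRootsOfUnity.natCard_rootsOfUnity (AlgebraicClosure K) N)).comp
    (MulSemiringAction.toRingAut Gal(AlgebraicClosure K/K) (AlgebraicClosure K))

/-- The subgroup `B₁(N)` of `GL₂(ℤ/Nℤ)` of the invertible matrices `(1 b; 0 d)`. -/
def B1 (N : ℕ) : Subgroup (GL (Fin 2) (ZMod N)) where
  carrier := {g | ∃ (b : ZMod N) (d : (ZMod N)ˣ),
    (g : Matrix (Fin 2) (Fin 2) (ZMod N)) = !![1, b; 0, (d : ZMod N)]}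
  one_mem' := ⟨0, 1, by simp [Matrix.one_fin_two]⟩
  mul_mem' := by
    rintro g h ⟨b, d, hg⟩ ⟨b', d', hh⟩
    exact ⟨b' + b * d', d * d', by simp [hg, hh]⟩
  inv_mem' := by
    rintro g ⟨b, d, hg⟩
    refine ⟨-b * (d⁻¹ : (ZMod N)ˣ), d⁻¹, ?_⟩
    refine (left_inv_eq_right_inv (a := (g : Matrix (Fin 2) (Fin 2) (ZMod N))) ?_ ?_)
    · exact Units.inv_mul g
    · simp [hg, Matrix.one_fin_two]

end

end ModNGalois

/-! The hard implication is (a) → (b). A fixed point `P` of order `N` gives the first column `(1,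
0)`; that the lower right entry is `χ_N` needs the Weil pairing, but only one slot of it: a
character `ψ` from `E[N]` to the units of the algebraic closure with `ψ P = 1`, with `ψ (σ Q) = σ (ψ
Q)` for every `σ` fixing `P`, and nondegenerate (`ψ ^ d = 1` forces `d • P = 0`). If `P` has order
`N`, some `ψ Q` has order `N`; then `P, Q` is a basis, and applying `ψ` to `σ Q = β P + δ Q` gives
`σ (ψ Q) = ψ Q ^ δ`, so `δ = χ_N σ` (`exists_basis_matrixRep_eq`). The same argument proves
freeness. For (c) → (a), the vector `g⁻¹ e₁` gives a fixed point of order `N`, whose coordinates lie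
in `K` because `K` is perfect.

The character (`exists_weilPairing`) is built in the function field `L` over `F`, the algebraic
closure of `K`, from a single valuation `v` at infinity and the translations `tau S`: the order of
`f` at `S` is read off from `v (tau S f)`. Write `P = n • P'` and let `g` have divisor `∑ ((P' + Q)
- (Q))` over `Q` in `E[n]`; then `tau Q g = ψ Q * g`. Nondegeneracy comes from descent: if `g ^ d`
is `E[n]`-invariant, it is `u ∘ [n]` with `div u = d((P) - (O))`, whence `d • P = 0`.

Three inputs are needed. The `x`-coordinate of `[n]` is a reduced fraction with numerator of degree
`n ^ 2` and, for `n` invertible, denominator of degree `n ^ 2 - 1` (`exists_isMulPair`); this gives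
surjectivity of `[n]`, its unramifiedness at the origin and `#E[n] = n ^ 2`. The map `P ↦ (P) - (O)`
to divisor classes is an injective homomorphism (`cls_add`, `eq_zero_of_cls_eq_zero`). Invariant
functions with poles only in `E[n]` are pullbacks (`IsTorsionInvariant.exists_mulPull`). -/

open Polynomial WithZero
open scoped Polynomial.Bivariate
set_option linter.unusedSectionVars false

universe u v w

/-- A presentation of a field `L` as the function field over `F` of a Weierstrass curve `E`: the
coordinates `(x, y)` of a generic point, the valuation at infinity, and the lifting property. -/
structure FunctionFieldModel {K : Type u} [Field K] (E : WeierstrassCurve K) (F : Type v) (L : Type w)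
    [Field F] [Field L] [Algebra K F] [Algebra F L] [Algebra K L] where
  /-- The first coordinate function. -/
  x : L
  /-- The second coordinate function. -/
  y : L
  /-- The valuation at infinity, measuring orders of poles. -/
  v : Valuation L ℤᵐ⁰
  equation : (E⁄L).Equation x y
  trivial : v.IsTrivialOn F
  v_x : v x = exp 2
  v_y : v y = exp 3
  exists_rep : ∀ f : L, ∃ p q r : F[X], r ≠ 0 ∧ f * aeval x r = aeval x p + aeval x q * y
  -- With `σ = id` this yields translations, negation and multiplication by `n`; a general `σ`
  -- yields the Galois action on functions.
  exists_lift : ∀ (σ : F →ₐ[K] F) (a b : L), (E⁄L).Equation a b → Transcendental F a →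
    ∃ φ : L →ₐ[K] L, φ x = a ∧ φ y = b ∧ ∀ c, φ (algebraMap F L c) = algebraMap F L (σ c)

/-! ### The coordinate ring: pole order at infinity, and evaluation at points. -/

namespace WeierstrassCurve.Affine.CoordinateRing

section

variable {F : Type u} [Field F] (W : Affine F)

lemma norm_eq_zero_iff {f : W.CoordinateRing} : Algebra.norm F[X] f = 0 ↔ f = 0 :=
  haveI : Module.Finite F[X] W.CoordinateRing := .of_basis (CoordinateRing.basis W)
  Algebra.norm_eq_zero_iff

/-- The norm of `p + q y` has degree `max (2 deg p) (2 deg q + 3)`, so the bound reduces to the one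
for polynomials. -/
lemma degree_norm_add_le (f g : W.CoordinateRing) : (Algebra.norm F[X] (f + g)).degree ≤
    max (Algebra.norm F[X] f).degree (Algebra.norm F[X] g).degree := by
  obtain ⟨p, q, rfl⟩ := exists_smul_basis_eq f
  obtain ⟨p', q', rfl⟩ := exists_smul_basis_eq g
  have : p • (1 : W.CoordinateRing) + q • mk W Y + (p' • (1 : W.CoordinateRing) + q' • mk W Y) =
      (p + p') • (1 : W.CoordinateRing) + (q + q') • mk W Y := by
    rw [add_smul, add_smul]; abel
  rw [this, degree_norm_smul_basis, degree_norm_smul_basis, degree_norm_smul_basis]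
  refine max_le ?_ ?_
  · rcases le_max_iff.mp (degree_add_le p p') with h | h
    · exact (nsmul_le_nsmul_right h 2).trans ((le_max_left _ _).trans (le_max_left _ _))
    · exact (nsmul_le_nsmul_right h 2).trans ((le_max_left _ _).trans (le_max_right _ _))
  · rcases le_max_iff.mp (degree_add_le q q') with h | h
    · exact (add_le_add_left (nsmul_le_nsmul_right h 2) 3).trans
        ((le_max_right _ _).trans (le_max_left _ _))
    · exact (add_le_add_left (nsmul_le_nsmul_right h 2) 3).trans
        ((le_max_right _ _).trans (le_max_right _ _))

open Classical in
/-- The order of the pole at infinity, as a valuation on the affine coordinate ring. -/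
noncomputable def inftyValuation : Valuation W.CoordinateRing ℤᵐ⁰ where
  toFun f := if f = 0 then 0 else exp ((Algebra.norm F[X] f).natDegree : ℤ)
  map_zero' := by simp
  map_one' := by simp
  map_mul' f g := by
    by_cases hf : f = 0
    · simp [hf]
    by_cases hg : g = 0
    · simp [hg]
    rw [if_neg (mul_ne_zero hf hg), if_neg hf, if_neg hg, map_mul, natDegree_mul
      ((norm_eq_zero_iff W).not.mpr hf) ((norm_eq_zero_iff W).not.mpr hg), Nat.cast_add, exp_add]
  map_add_le_max' f g := by
    by_cases hfg : f + g = 0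
    · simp [hfg]
    by_cases hf : f = 0
    · simp [hf]
    by_cases hg : g = 0
    · simp [hg]
    rw [if_neg hfg, if_neg hf, if_neg hg]
    have h := degree_norm_add_le W f g
    rw [degree_eq_natDegree ((norm_eq_zero_iff W).not.mpr hfg),
      degree_eq_natDegree ((norm_eq_zero_iff W).not.mpr hf),
      degree_eq_natDegree ((norm_eq_zero_iff W).not.mpr hg), le_max_iff] at h
    rw [le_max_iff, exp_le_exp, exp_le_exp]
    exact_mod_cast h

lemma inftyValuation_apply {f : W.CoordinateRing} (hf : f ≠ 0) :
    inftyValuation W f = exp ((Algebra.norm F[X] f).natDegree : ℤ) := if_neg hf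

lemma inftyValuation_C {p : F[X]} (hp : p ≠ 0) :
    inftyValuation W (mk W (C p)) = exp (2 * p.natDegree : ℤ) := by
  have h0 : mk W (C p) = p • (1 : W.CoordinateRing) + (0 : F[X]) • mk W Y := by
    rw [zero_smul, add_zero, smul, mul_one]
  have hne : mk W (C p) ≠ 0 := by
    rw [h0]; intro h; exact hp (smul_basis_eq_zero h).1
  rw [inftyValuation_apply W hne, h0, norm_smul_basis]
  have : p ^ 2 - p * 0 * (C W.a₁ * X + C W.a₃) -
      0 ^ 2 * (X ^ 3 + C W.a₂ * X ^ 2 + C W.a₄ * X + C W.a₆) = p ^ 2 := by ring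
  rw [this, natDegree_pow, Nat.cast_mul]
  rfl

lemma inftyValuation_Y : inftyValuation W (mk W Y) = exp 3 := by
  have h0 : mk W Y = (0 : F[X]) • (1 : W.CoordinateRing) + (1 : F[X]) • mk W Y := by
    rw [zero_smul, zero_add, one_smul]
  have hne : mk W Y ≠ 0 := by
    rw [h0]; intro h; exact one_ne_zero (smul_basis_eq_zero h).2
  have h3 : (Algebra.norm F[X] (mk W Y)).degree = (3 : ℕ) := by
    rw [h0, degree_norm_smul_basis, degree_zero, degree_one]
    rfl
  rw [inftyValuation_apply W hne, natDegree_eq_of_degree_eq_some h3]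
  rfl

lemma inftyValuation_primeCompl :
    nonZeroDivisors W.CoordinateRing ≤ (inftyValuation W).supp.primeCompl := by
  intro f hf h
  have : inftyValuation W f = 0 := h
  rw [inftyValuation_apply W (nonZeroDivisors.ne_zero hf)] at this
  exact exp_ne_zero this

end

section lift

variable {F : Type u} [Field F] (W : Affine F) {Ω : Type w} [Field Ω]

/-- The evaluation of an element of the affine coordinate ring at a point. -/
noncomputable def evalHom (i : F →+* Ω) (a b : Ω) (h : (W.map i).toAffine.Equation a b) :
    W.CoordinateRing →+* Ω :=
  AdjoinRoot.lift (eval₂RingHom i a) b <| by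
    have h' : (W.map i).toAffine.polynomial.evalEval a b = 0 := h
    rw [WeierstrassCurve.Affine.map_polynomial] at h'
    rw [← h', ← eval₂_eval₂RingHom_apply]

lemma evalHom_C (i : F →+* Ω) (a b : Ω) (h : (W.map i).toAffine.Equation a b) (p : F[X]) :
    evalHom W i a b h (mk W (C p)) = p.eval₂ i a :=
  AdjoinRoot.lift_of _

lemma evalHom_Y (i : F →+* Ω) (a b : Ω) (h : (W.map i).toAffine.Equation a b) :
    evalHom W i a b h (mk W Y) = b :=
  AdjoinRoot.lift_root _

/-- The norm of `f` is a polynomial in `x` and a multiple of `f`; if `f` evaluates to zero, so does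
its norm, which is then zero by the hypothesis on `a`. -/
lemma evalHom_injective (i : F →+* Ω) (a b : Ω) (h : (W.map i).toAffine.Equation a b)
    (ha : ∀ p : F[X], p.eval₂ i a = 0 → p = 0) : Function.Injective (evalHom W i a b h) := by
  rw [injective_iff_map_eq_zero]
  intro f hf
  obtain ⟨p, q, rfl⟩ := exists_smul_basis_eq f
  rw [← norm_eq_zero_iff]
  apply ha
  have h1 := coe_norm_smul_basis (W' := W) p q
  have h2 : mk W (C p + C q * Y) = p • (1 : W.CoordinateRing) + q • mk W Y := by
    rw [map_add, map_mul, smul, smul, mul_one]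
  rw [← evalHom_C W i a b h]
  refine (congrArg (evalHom W i a b h) h1).trans ?_
  rw [map_mul (mk W), map_mul, h2, hf, zero_mul]

end lift

end WeierstrassCurve.Affine.CoordinateRing

/-! ### The function field satisfies the axioms of a model. -/

namespace WeierstrassCurve.Affine.FunctionField

open CoordinateRing hiding map map_mk map_injective

variable {K : Type u} [Field K] (E : WeierstrassCurve K) (F : Type v) [Field F] [Algebra K F]

/-- The embedding of the affine coordinate ring into the function field. -/
noncomputable def ofRing : (E⁄F).CoordinateRing →+* (E⁄F).FunctionField :=
  algebraMap (E⁄F).CoordinateRing (E⁄F).FunctionField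

lemma ofRing_injective : Function.Injective (ofRing E F) :=
  IsFractionRing.injective (E⁄F).CoordinateRing (E⁄F).FunctionField

lemma ofRing_C_C (c : F) :
    ofRing E F (CoordinateRing.mk (E⁄F) (C (C c))) = algebraMap F (E⁄F).FunctionField c := rfl

lemma ofRing_C (p : F[X]) :
    ofRing E F (CoordinateRing.mk (E⁄F) (C p)) = aeval (ofRing E F (CoordinateRing.mk (E⁄F) (C X))) p := by
  induction p using Polynomial.induction_on' with
  | add p q hp hq => simp only [map_add, hp, hq]
  | monomial n c =>
    rw [← C_mul_X_pow_eq_monomial]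
    simp only [map_mul, map_pow, aeval_C, aeval_X, ofRing_C_C]

lemma equation_generic : (E⁄(E⁄F).FunctionField).Equation
    (ofRing E F (CoordinateRing.mk (E⁄F) (C X))) (ofRing E F (CoordinateRing.mk (E⁄F) Y)) := by
  have h0 : CoordinateRing.mk (E⁄F) (Y ^ 2 + C (C (E⁄F).a₁ * X + C (E⁄F).a₃) * Y -
      C (X ^ 3 + C (E⁄F).a₂ * X ^ 2 + C (E⁄F).a₄ * X + C (E⁄F).a₆)) = 0 := AdjoinRoot.mk_self
  have h := congrArg (ofRing E F) h0
  simp only [map_add, map_sub, map_mul, map_pow, map_zero, ofRing_C_C] at h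
  have e (c : K) : algebraMap K (E⁄F).FunctionField c =
      algebraMap F (E⁄F).FunctionField (algebraMap K F c) := IsScalarTower.algebraMap_apply ..
  rw [equation_iff']
  refine Eq.trans ?_ h
  have e1 : (E⁄(E⁄F).FunctionField).a₁ = algebraMap F _ (E⁄F).a₁ := e _
  have e2 : (E⁄(E⁄F).FunctionField).a₂ = algebraMap F _ (E⁄F).a₂ := e _
  have e3 : (E⁄(E⁄F).FunctionField).a₃ = algebraMap F _ (E⁄F).a₃ := e _
  have e4 : (E⁄(E⁄F).FunctionField).a₄ = algebraMap F _ (E⁄F).a₄ := e _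
  have e6 : (E⁄(E⁄F).FunctionField).a₆ = algebraMap F _ (E⁄F).a₆ := e _
  rw [e1, e2, e3, e4, e6]
  ring

/-- The denominator is rationalised: multiplying by its conjugate turns it into its norm, a
polynomial in `x`. -/
lemma exists_rep (f : (E⁄F).FunctionField) : ∃ p q r : F[X], r ≠ 0 ∧
    f * aeval (ofRing E F (CoordinateRing.mk (E⁄F) (C X))) r = aeval (ofRing E F (CoordinateRing.mk (E⁄F) (C X))) p +
      aeval (ofRing E F (CoordinateRing.mk (E⁄F) (C X))) q * ofRing E F (CoordinateRing.mk (E⁄F) Y) := by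
  obtain ⟨g, d, hd, rfl⟩ := IsFractionRing.div_surjective (A := (E⁄F).CoordinateRing) f
  have hd0 := nonZeroDivisors.ne_zero hd
  obtain ⟨s, t, rfl⟩ := exists_smul_basis_eq d
  set d := s • (1 : (E⁄F).CoordinateRing) + t • CoordinateRing.mk (E⁄F) Y
  have h1 := coe_norm_smul_basis (W' := (E⁄F)) s t
  rw [map_mul (CoordinateRing.mk (E⁄F))] at h1
  have h2 : CoordinateRing.mk (E⁄F) (C s + C t * Y) = d := by
    rw [map_add, map_mul]; simp only [d, smul, mul_one]
  rw [h2] at h1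
  set d' := CoordinateRing.mk (E⁄F) (C s + C t * (-(Y : F[X][Y]) - C (C (E⁄F).a₁ * X + C (E⁄F).a₃)))
  obtain ⟨p, q, hpq⟩ := exists_smul_basis_eq (g * d')
  refine ⟨p, q, Algebra.norm F[X] d, (norm_eq_zero_iff _).not.mpr hd0, ?_⟩
  rw [← ofRing_C, ← ofRing_C, ← ofRing_C]
  have h3 : ofRing E F (CoordinateRing.mk (E⁄F) (C (Algebra.norm F[X] d))) = ofRing E F d * ofRing E F d' := by
    rw [← map_mul]; exact congrArg _ h1
  have h4 : ofRing E F d ≠ 0 := by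
    rw [Ne, map_eq_zero_iff _ (ofRing_injective E F)]; exact hd0
  rw [h3]
  have h5 : CoordinateRing.mk (E⁄F) (C p) + CoordinateRing.mk (E⁄F) (C q) * CoordinateRing.mk (E⁄F) Y = g * d' := by
    rw [← hpq, smul, smul, mul_one]
  rw [← map_mul (ofRing E F) (CoordinateRing.mk (E⁄F) (C q)), ← map_add (ofRing E F), h5, map_mul]
  change ofRing E F g / ofRing E F d * _ = _
  field_simp

/-- The valuation at infinity of the function field. -/
noncomputable def inftyVal : Valuation (E⁄F).FunctionField ℤᵐ⁰ :=
  (inftyValuation (E⁄F)).extendToLocalization (inftyValuation_primeCompl (E⁄F)) _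

lemma inftyVal_ofRing (f : (E⁄F).CoordinateRing) :
    inftyVal E F (ofRing E F f) = inftyValuation (E⁄F) f :=
  Valuation.extendToLocalization_apply_map_apply ..

lemma exists_lift (σ : F →ₐ[K] F) (a b : (E⁄F).FunctionField)
    (h : (E⁄(E⁄F).FunctionField).Equation a b) (ha : Transcendental F a) :
    ∃ φ : (E⁄F).FunctionField →ₐ[K] (E⁄F).FunctionField,
      φ (ofRing E F (CoordinateRing.mk (E⁄F) (C X))) = a ∧ φ (ofRing E F (CoordinateRing.mk (E⁄F) Y)) = b ∧
      ∀ c, φ (algebraMap F _ c) = algebraMap F _ (σ c) := by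
  let i : F →+* (E⁄F).FunctionField := (algebraMap F _).comp σ.toRingHom
  have hE : (E⁄F).map i = E⁄(E⁄F).FunctionField := by
    simp only [WeierstrassCurve.baseChange, WeierstrassCurve.map_map]
    congr 1
    ext c
    change algebraMap F _ (σ (algebraMap K F c)) = _
    rw [σ.commutes, ← IsScalarTower.algebraMap_apply]
  have h' : ((E⁄F).map i).toAffine.Equation a b := hE ▸ h
  have hi : ∀ p : F[X], p.eval₂ i a = 0 → p = 0 := by
    intro p hp
    have : aeval a (p.map σ.toRingHom) = 0 := by
      rw [aeval_def, eval₂_map]; exact hp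
    exact (Polynomial.map_eq_zero_iff σ.injective).mp (transcendental_iff.mp ha _ this)
  let ψ := IsFractionRing.lift (A := (E⁄F).CoordinateRing) (K := (E⁄F).FunctionField)
    (evalHom_injective (E⁄F) i a b h' hi)
  have hψ (f : (E⁄F).CoordinateRing) : ψ (ofRing E F f) = evalHom (E⁄F) i a b h' f :=
    IsFractionRing.lift_algebraMap _ f
  have hc (c : F) : ψ (algebraMap F _ c) = algebraMap F _ (σ c) := by
    rw [← ofRing_C_C, hψ, evalHom_C, eval₂_C]
    rfl
  refine ⟨{ ψ with commutes' := fun c ↦ ?_ }, ?_, ?_, hc⟩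
  · change ψ _ = _
    rw [IsScalarTower.algebraMap_apply K F, hc, σ.commutes]
  · exact (hψ _).trans (by rw [evalHom_C, eval₂_X])
  · exact (hψ _).trans (evalHom_Y ..)

/-- The function field of a Weierstrass curve as a model. -/
noncomputable def model : FunctionFieldModel E F (E⁄F).FunctionField where
  x := ofRing E F (CoordinateRing.mk (E⁄F) (C X))
  y := ofRing E F (CoordinateRing.mk (E⁄F) Y)
  v := inftyVal E F
  equation := equation_generic E F
  trivial := ⟨fun c hc ↦ by
    rw [← ofRing_C_C, inftyVal_ofRing, inftyValuation_C _ (C_ne_zero.mpr hc), natDegree_C]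
    rfl⟩
  v_x := by rw [inftyVal_ofRing, inftyValuation_C _ X_ne_zero, natDegree_X]; rfl
  v_y := by rw [inftyVal_ofRing, inftyValuation_Y]
  exists_rep := exists_rep E F
  exists_lift := exists_lift E F

end WeierstrassCurve.Affine.FunctionField

/-! ### Valuations trivial on constants, and the valuation at infinity. -/

namespace FunctionFieldModel

variable {K : Type u} [Field K] {E : WeierstrassCurve K} {F : Type v} {L : Type w} [Field F]
  [Field L] [Algebra K F] [Algebra F L] [Algebra K L] [IsScalarTower K F L]
  (M : FunctionFieldModel E F L)

attribute [instance] FunctionFieldModel.trivial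

lemma exp_two_mul_eq_pow (e n : ℕ) : (exp (2 * e : ℤ) : ℤᵐ⁰) ^ n = exp (2 * (e * n) : ℤ) := by
  rw [← exp_nsmul]; congr 1; simp; ring

lemma sq_eq_exp {a : ℤᵐ⁰} {k : ℤ} (h : a ^ 2 = exp (2 * k)) : a = exp k := by
  have ha : a ≠ 0 := by
    rintro rfl
    rw [zero_pow two_ne_zero] at h
    exact exp_ne_zero h.symm
  have := congrArg log h
  rw [log_pow, log_exp, nsmul_eq_mul] at this
  rw [← exp_log ha]
  congr 1
  push_cast at this
  omega

section valuation

variable (w : Valuation L ℤᵐ⁰) [w.IsTrivialOn F]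

lemma val_algebraMap_le_one (c : F) : w (algebraMap F L c) ≤ 1 := by
  by_cases hc : c = 0
  · simp [hc]
  · rw [Valuation.IsTrivialOn.eq_one (v := w) c hc]

lemma val_aeval_le_one {a : L} (ha : w a ≤ 1) (p : F[X]) : w (aeval a p) ≤ 1 := by
  rw [aeval_eq_sum_range]
  refine w.map_sum_le fun i _ ↦ ?_
  rw [Algebra.smul_def, map_mul, map_pow]
  exact mul_le_one' (val_algebraMap_le_one w _) (pow_le_one' ha _)

lemma val_aeval_sub_lt_one {a : L} {c : F} (h : w (a - algebraMap F L c) < 1) (p : F[X]) :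
    w (aeval a p - algebraMap F L (p.eval c)) < 1 := by
  have ha : w a ≤ 1 := by
    have : a = (a - algebraMap F L c) + algebraMap F L c := by ring
    rw [this]
    exact w.map_add_le h.le (val_algebraMap_le_one w c)
  obtain ⟨q, hq⟩ := X_sub_C_dvd_sub_C_eval (a := c) (p := p)
  have : aeval a p - algebraMap F L (p.eval c) = (a - algebraMap F L c) * aeval a q := by
    have := congrArg (aeval a) hq
    simpa using this
  rw [this, map_mul]
  exact mul_lt_one_of_nonneg_of_lt_one_left zero_le h (val_aeval_le_one w ha q)

lemma val_eq_one_of_sub_lt_one {a : L} {c : F} (hc : c ≠ 0) (h : w (a - algebraMap F L c) < 1) :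
    w a = 1 := by
  have h1 := Valuation.IsTrivialOn.eq_one (v := w) c hc
  rw [← h1]
  exact w.map_eq_of_sub_lt (by rwa [h1])

lemma val_aeval_eq_one {a : L} {c : F} (h : w (a - algebraMap F L c) < 1) {p : F[X]}
    (hp : p.eval c ≠ 0) : w (aeval a p) = 1 :=
  val_eq_one_of_sub_lt_one w hp (val_aeval_sub_lt_one w h p)

lemma val_sub_eq_one {a : L} {c d : F} (h : w (a - algebraMap F L c) < 1) (hd : c ≠ d) :
    w (a - algebraMap F L d) = 1 := by
  have := val_aeval_eq_one w h (p := X - C d) (by simpa [sub_eq_zero] using hd)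
  simpa using this

lemma eq_of_sub_lt_one {a : L} {c d : F} (h : w (a - algebraMap F L c) < 1)
    (h' : w (a - algebraMap F L d) < 1) : c = d := by
  by_contra hd
  exact h'.ne (val_sub_eq_one w h hd)

end valuation

lemma v_const {c : F} (hc : c ≠ 0) : M.v (algebraMap F L c) = 1 :=
  Valuation.IsTrivialOn.eq_one (v := M.v) c hc

lemma v_aeval {p : F[X]} (hp : p ≠ 0) : M.v (aeval M.x p) = exp (2 * p.natDegree : ℤ) := by
  rw [valuation_aeval_eq_valuation_X_pow_natDegree_of_one_lt_valuation_X _ _ hp, M.v_x,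
    ← exp_nsmul]
  · congr 1; simp; ring
  · rw [M.v_x, ← exp_zero, exp_lt_exp]; norm_num

lemma transcendental_x : Transcendental F M.x :=
  Valuation.transcendental_of_ne_one (v := M.v) F M.x
    (by rw [← M.v.ne_zero_iff, M.v_x]; exact exp_ne_zero)
    (by rw [M.v_x, Ne, exp_eq_one]; norm_num)

lemma aeval_x_eq_zero {p : F[X]} : aeval M.x p = 0 ↔ p = 0 :=
  ⟨transcendental_iff.mp M.transcendental_x p, fun h ↦ by rw [h, map_zero]⟩

lemma aeval_x_inj {p q : F[X]} : aeval M.x p = aeval M.x q ↔ p = q := by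
  rw [← sub_eq_zero, ← map_sub, aeval_x_eq_zero, sub_eq_zero]

lemma x_ne_const (c : F) : M.x ≠ algebraMap F L c := by
  intro h
  have := M.aeval_x_eq_zero (p := X - C c)
  simp [h, X_sub_C_ne_zero] at this

lemma equation_iff {a b : L} : (E⁄L).Equation a b ↔
    b ^ 2 + algebraMap F L (E⁄F).a₁ * a * b + algebraMap F L (E⁄F).a₃ * b =
      a ^ 3 + algebraMap F L (E⁄F).a₂ * a ^ 2 + algebraMap F L (E⁄F).a₄ * a +
        algebraMap F L (E⁄F).a₆ := by
  have e (c : K) : algebraMap F L (algebraMap K F c) = algebraMap K L c :=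
    (IsScalarTower.algebraMap_apply ..).symm
  have e1 : (E⁄L).a₁ = algebraMap F L (E⁄F).a₁ := (e _).symm
  have e2 : (E⁄L).a₂ = algebraMap F L (E⁄F).a₂ := (e _).symm
  have e3 : (E⁄L).a₃ = algebraMap F L (E⁄F).a₃ := (e _).symm
  have e4 : (E⁄L).a₄ = algebraMap F L (E⁄F).a₄ := (e _).symm
  have e6 : (E⁄L).a₆ = algebraMap F L (E⁄F).a₆ := (e _).symm
  rw [WeierstrassCurve.Affine.equation_iff, e1, e2, e3, e4, e6]

/-- In `b (b + a₁ a + a₃) = a³ + ⋯` the right side has a pole of order `6e`. If the pole of `b` were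
at most that of `a`, the left side would have order at most `4e`; so `b` dominates its factor and
`b²` has order `6e`. -/
lemma val_y {w : Valuation L ℤᵐ⁰} [w.IsTrivialOn F] {e : ℕ} (he : 0 < e) {a b : L}
    (h : (E⁄L).Equation a b) (ha : w a = exp (2 * e : ℤ)) : w b = exp (3 * e : ℤ) := by
  rw [equation_iff (F := F)] at h
  have h1 : 1 < w a := by rw [ha, ← exp_zero, exp_lt_exp]; omega
  set p : F[X] := X ^ 3 + C (E⁄F).a₂ * X ^ 2 + C (E⁄F).a₄ * X + C (E⁄F).a₆ with hp
  have hpd : p.natDegree = 3 := by rw [hp]; compute_degree!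
  have hp0 : p ≠ 0 := by rintro h; rw [h] at hpd; simp at hpd
  have h2 := valuation_aeval_eq_valuation_X_pow_natDegree_of_one_lt_valuation_X (v := w) a h1 hp0
  have h3 : aeval a p = b * (b + (algebraMap F L (E⁄F).a₁ * a + algebraMap F L (E⁄F).a₃)) := by
    rw [hp]; simp only [map_add, map_mul, map_pow, aeval_C, aeval_X]; linear_combination -h
  rw [h3, hpd, ha, exp_two_mul_eq_pow, map_mul] at h2
  have h4 : w (algebraMap F L (E⁄F).a₁ * a + algebraMap F L (E⁄F).a₃) ≤ exp (2 * e : ℤ) := by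
    rw [← ha]
    refine w.map_add_le ?_ ((val_algebraMap_le_one w _).trans h1.le)
    rw [map_mul]
    exact mul_le_of_le_one_left' (val_algebraMap_le_one w _)
  rcases le_or_gt (w b) (exp (2 * e : ℤ)) with h5 | h5
  · exfalso
    have h6 := mul_le_mul' h5 (w.map_add_le h5 h4)
    rw [h2, ← exp_add, exp_le_exp] at h6
    push_cast at h6
    omega
  · rw [w.map_add_eq_of_lt_left (h4.trans_lt h5), ← sq] at h2
    apply sq_eq_exp
    rw [h2]; congr 1; push_cast; ring

/-- Pole orders are even for polynomials in `x` and odd for polynomials in `x` times `y`. -/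
lemma v_aeval_ne_v_aeval_mul_y {p q : F[X]} (hq : q ≠ 0) :
    M.v (aeval M.x p) ≠ M.v (aeval M.x q * M.y) := by
  by_cases hp : p = 0
  · rw [hp, map_zero, map_zero, map_mul, M.v_aeval hq, M.v_y, ← exp_add]
    exact exp_ne_zero.symm
  · rw [map_mul, M.v_aeval hp, M.v_aeval hq, M.v_y, ← exp_add, Ne, exp_inj]
    omega

lemma v_aeval_add (p q : F[X]) : M.v (aeval M.x p + aeval M.x q * M.y) =
    max (M.v (aeval M.x p)) (M.v (aeval M.x q * M.y)) := by
  by_cases hq : q = 0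
  · simp [hq]
  · exact M.v.map_add_of_distinct_val (M.v_aeval_ne_v_aeval_mul_y hq)

/-- A valuation trivial on constants is determined by its pole order at `x`, since parity still
separates the two terms of `p + q y`. It is applied to pullbacks of `v` along negation, `[n]` and
Galois twists. -/
lemma val_eq_pow {w : Valuation L ℤᵐ⁰} [w.IsTrivialOn F] {e : ℕ} (he : 0 < e)
    (hx : w M.x = exp (2 * e : ℤ)) (f : L) : w f = M.v f ^ e := by
  have h1 : 1 < w M.x := by rw [hx, ← exp_zero, exp_lt_exp]; omega
  have hy := val_y (F := F) he M.equation hx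
  have hP (p : F[X]) : w (aeval M.x p) = M.v (aeval M.x p) ^ e := by
    by_cases hp : p = 0
    · simp [hp, he.ne']
    · rw [valuation_aeval_eq_valuation_X_pow_natDegree_of_one_lt_valuation_X _ h1 hp,
        M.v_aeval hp, hx, ← exp_nsmul, ← exp_nsmul]
      congr 1; simp; ring
  have hY : w M.y = M.v M.y ^ e := by
    rw [hy, M.v_y, ← exp_nsmul]; congr 1; simp; ring
  obtain ⟨p, q, r, hr, h⟩ := M.exists_rep f
  have hr0 : aeval M.x r ≠ 0 := M.aeval_x_eq_zero.not.mpr hr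
  have key : w (aeval M.x p + aeval M.x q * M.y) = M.v (aeval M.x p + aeval M.x q * M.y) ^ e := by
    by_cases hq : q = 0
    · simp [hq, hP]
    have hQ : w (aeval M.x q * M.y) = M.v (aeval M.x q * M.y) ^ e := by
      rw [map_mul, hP, hY, ← mul_pow, ← map_mul]
    have hne : w (aeval M.x p) ≠ w (aeval M.x q * M.y) := by
      rw [hP, hQ]
      exact fun h ↦ M.v_aeval_ne_v_aeval_mul_y hq
        ((pow_left_inj₀ zero_le zero_le he.ne').mp h)
    have hmono : Monotone fun a : ℤᵐ⁰ ↦ a ^ e := fun a b h ↦ pow_le_pow_left₀ zero_le h e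
    rw [w.map_add_of_distinct_val hne, M.v_aeval_add, hP, hQ]
    exact (hmono.map_max).symm
  rw [← h, map_mul, map_mul, mul_pow, hP] at key
  exact mul_right_cancel₀ (pow_ne_zero _ (M.v.ne_zero_iff.mpr hr0)) key

/-- When `v f = 1`, parity makes the term in `y` negligible, so `f` behaves as `p / r` with `p`, `r`
of equal degree; the residue is the quotient of leading coefficients. -/
lemma exists_residue {f : L} (hf : M.v f ≤ 1) : ∃ c : F, M.v (f - algebraMap F L c) < 1 := by
  rcases hf.lt_or_eq with h1 | h1
  · exact ⟨0, by simpa using h1⟩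
  obtain ⟨p, q, r, hr, h⟩ := M.exists_rep f
  have hr0 : aeval M.x r ≠ 0 := M.aeval_x_eq_zero.not.mpr hr
  have h2 := congrArg M.v h
  rw [map_mul, h1, one_mul, M.v_aeval_add] at h2
  have hqlt : M.v (aeval M.x q * M.y) < M.v (aeval M.x r) := by
    by_cases hq : q = 0
    · rw [hq, map_zero, zero_mul, map_zero]
      exact M.v.pos_iff.mpr hr0
    · exact lt_of_le_of_ne (h2 ▸ le_max_right _ _) (M.v_aeval_ne_v_aeval_mul_y hq).symm
  have hpr : M.v (aeval M.x p) = M.v (aeval M.x r) := by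
    rcases max_choice (M.v (aeval M.x p)) (M.v (aeval M.x q * M.y)) with h3 | h3
    · rw [h2, h3]
    · rw [h3] at h2; exact absurd h2 hqlt.ne'
  have hp : p ≠ 0 := by
    rintro rfl
    rw [map_zero, map_zero] at hpr
    exact hr0 (M.v.zero_iff.mp hpr.symm)
  have hdeg : p.natDegree = r.natDegree := by
    rw [M.v_aeval hp, M.v_aeval hr, exp_inj] at hpr
    omega
  set c := p.leadingCoeff / r.leadingCoeff
  refine ⟨c, ?_⟩
  have hlt : M.v (aeval M.x (p - C c * r)) < M.v (aeval M.x r) := by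
    by_cases h0 : p - C c * r = 0
    · rw [h0, map_zero, map_zero]
      exact M.v.pos_iff.mpr hr0
    · have hc : c ≠ 0 := div_ne_zero (leadingCoeff_ne_zero.mpr hp) (leadingCoeff_ne_zero.mpr hr)
      have hlt : (p - C c * r).degree < p.degree := by
        refine degree_sub_lt_left ?_ hp ?_
        · rw [degree_C_mul hc, degree_eq_natDegree hp, degree_eq_natDegree hr, hdeg]
        · rw [leadingCoeff_mul, leadingCoeff_C, div_mul_cancel₀ _ (leadingCoeff_ne_zero.mpr hr)]
      have := natDegree_lt_natDegree h0 hlt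
      rw [M.v_aeval h0, M.v_aeval hr, exp_lt_exp]
      omega
  have h5 : (f - algebraMap F L c) * aeval M.x r =
      aeval M.x (p - C c * r) + aeval M.x q * M.y := by
    rw [map_sub, map_mul, aeval_C]; linear_combination h
  have h6 : M.v (f - algebraMap F L c) * M.v (aeval M.x r) < 1 * M.v (aeval M.x r) := by
    rw [← map_mul, h5, one_mul]
    exact M.v.map_add_lt hlt hqlt
  exact lt_of_mul_lt_mul_right h6 zero_le

end FunctionFieldModel

/-! ### The generic point, translations of functions, and divisors. -/

namespace FunctionFieldModel

open WeierstrassCurve.Affine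

section points

variable {K : Type u} [Field K] {E : WeierstrassCurve K} {F : Type v} {L : Type w} [Field F]
  [Field L] [Algebra K F] [Algebra F L] [Algebra K L] [IsScalarTower K F L]
  (M : FunctionFieldModel E F L) [E.IsElliptic] [DecidableEq F] [DecidableEq L]

instance : (E⁄L).IsElliptic := inferInstanceAs (E.map (algebraMap K L)).IsElliptic

/-- A constant point, seen over the function field. -/
noncomputable abbrev const (_M : FunctionFieldModel E F L) : (E⁄F).Point →+ (E⁄L).Point :=
  Point.baseChange F L

/-- The generic point. -/
noncomputable def gen : (E⁄L).Point := .some M.x M.y (equation_iff_nonsingular.mp M.equation)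

lemma map_const (φ : L →ₐ[F] L) (S : (E⁄F).Point) : Point.map φ (M.const S) = M.const S :=
  Point.map_baseChange φ S

lemma const_some {a b : F} (h : (E⁄F).Nonsingular a b) : ∃ h',
    M.const (.some a b h) = .some (algebraMap F L a) (algebraMap F L b) h' := ⟨_, rfl⟩

lemma gen_ne_const (S : (E⁄F).Point) : M.gen ≠ M.const S := by
  intro h
  cases S with
  | zero => rw [← Point.zero_def, map_zero] at h; exact Point.some_ne_zero (equation_iff_nonsingular.mp M.equation) h
  | some a b hab =>
    obtain ⟨h', h''⟩ := M.const_some hab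
    rw [h'', gen, Point.some.injEq] at h
    exact M.x_ne_const a h.1

lemma ext_algHom {φ ψ : L →ₐ[K] L} (hx : φ M.x = ψ M.x) (hy : φ M.y = ψ M.y)
    (hc : ∀ c, φ (algebraMap F L c) = ψ (algebraMap F L c)) : φ = ψ := by
  have hP (p : F[X]) : φ (aeval M.x p) = ψ (aeval M.x p) := by
    induction p using Polynomial.induction_on' with
    | add p q hp hq => simp only [map_add, hp, hq]
    | monomial n c =>
      rw [← C_mul_X_pow_eq_monomial]
      simp only [map_mul, map_pow, aeval_C, aeval_X, hc, hx]
  ext f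
  obtain ⟨p, q, r, hr, h⟩ := M.exists_rep f
  have hr0 : φ (aeval M.x r) ≠ 0 := by
    rw [Ne, map_eq_zero]; exact M.aeval_x_eq_zero.not.mpr hr
  have h1 := congrArg φ h
  have h2 := congrArg ψ h
  rw [map_add, map_mul, map_mul] at h1 h2
  rw [← hP, ← hP, ← hP, ← hy] at h2
  exact mul_right_cancel₀ hr0 (h1.trans h2.symm)

/-- This turns identities between endomorphisms of `L` into identities in the group `E(L)`, where
they are formal. -/
lemma ext_of_map_gen {φ ψ : L →ₐ[F] L} (h : Point.map (W' := E) φ M.gen = Point.map ψ M.gen) :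
    φ = ψ := by
  rw [gen, Point.map_some, Point.map_some, Point.some.injEq] at h
  have : φ.restrictScalars K = ψ.restrictScalars K :=
    M.ext_algHom h.1 h.2 fun c ↦ (φ.commutes c).trans (ψ.commutes c).symm
  ext f
  exact DFunLike.congr_fun this f

variable [IsAlgClosed F]

/-- If the `x`-coordinate were algebraic over `F`, the Weierstrass equation would make the
`y`-coordinate algebraic too; both would lie in `F`, and the point would be constant. So it is
transcendental and the lifting property applies. -/
lemma exists_map_gen_eq {P : (E⁄L).Point} (hP : ∀ S, P ≠ M.const S) :
    ∃ φ : L →ₐ[F] L, Point.map φ M.gen = P := by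
  cases P with
  | zero => exact absurd (map_zero _).symm (hP 0)
  | some a b hab =>
    have hF {c : L} (hc : IsAlgebraic F c) : ∃ d : F, algebraMap F L d = c := by
      have hm := minpoly.irreducible hc.isIntegral
      have h1 := IsAlgClosed.degree_eq_one_of_irreducible F hm
      exact minpoly.mem_range_of_degree_eq_one F c h1
    have ha : Transcendental F a := by
      intro ha
      obtain ⟨c, rfl⟩ := hF ha
      have hb : IsAlgebraic F b := by
        refine ⟨X ^ 2 + C ((E⁄F).a₁ * c + (E⁄F).a₃) * X -
          C (c ^ 3 + (E⁄F).a₂ * c ^ 2 + (E⁄F).a₄ * c + (E⁄F).a₆), ?_, ?_⟩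
        · refine ne_of_apply_ne natDegree ?_
          have : (X ^ 2 + C ((E⁄F).a₁ * c + (E⁄F).a₃) * X -
            C (c ^ 3 + (E⁄F).a₂ * c ^ 2 + (E⁄F).a₄ * c + (E⁄F).a₆)).natDegree = 2 := by
            compute_degree!
          rw [this]; simp
        · have := (equation_iff (F := F)).mp hab.1
          simp only [map_add, map_sub, map_mul, map_pow, aeval_C, aeval_X]
          linear_combination this
      obtain ⟨d, rfl⟩ := hF hb
      have hcd : (E⁄F).Nonsingular c d :=
        (WeierstrassCurve.Affine.baseChange_nonsingular (W := E) (f := Algebra.ofId F L) (algebraMap F L).injective c d).mp hab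
      exact hP (.some c d hcd) rfl
    obtain ⟨φ, h1, h2, h3⟩ := M.exists_lift (AlgHom.id K F) a b hab.1 ha
    refine ⟨{ φ with commutes' := h3 }, ?_⟩
    rw [gen, Point.map_some, Point.some.injEq]
    exact ⟨h1, h2⟩

open Classical in
/-- The endomorphism of the function field given by a nonconstant point. -/
noncomputable def pull (P : (E⁄L).Point) : L →ₐ[F] L :=
  -- The identity is a default value: a constant point does not define an endomorphism of `L`.
  if h : ∀ S, P ≠ M.const S then (M.exists_map_gen_eq h).choose else AlgHom.id F L

lemma map_pull_gen {P : (E⁄L).Point} (hP : ∀ S, P ≠ M.const S) :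
    Point.map (M.pull P) M.gen = P := by
  rw [pull, dif_pos hP]
  exact (M.exists_map_gen_eq hP).choose_spec

lemma gen_add_const_ne (S T : (E⁄F).Point) : M.gen + M.const S ≠ M.const T := by
  rw [Ne, ← eq_sub_iff_add_eq, ← map_sub]
  exact M.gen_ne_const _

/-- Translation by a constant point, on functions. -/
noncomputable def tau (S : (E⁄F).Point) : L →ₐ[F] L := M.pull (M.gen + M.const S)

lemma map_tau_gen (S : (E⁄F).Point) : Point.map (M.tau S) M.gen = M.gen + M.const S :=
  M.map_pull_gen (M.gen_add_const_ne S)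

lemma tau_zero : M.tau 0 = AlgHom.id F L :=
  M.ext_of_map_gen <| by
    rw [map_tau_gen, map_zero, add_zero]
    exact (Point.map_id (W' := E) M.gen).symm

lemma tau_comp (S T : (E⁄F).Point) : (M.tau S).comp (M.tau T) = M.tau (S + T) :=
  M.ext_of_map_gen <| by
    rw [← Point.map_map, map_tau_gen, map_add, map_tau_gen, map_tau_gen, map_const, map_add,
      add_assoc]

lemma tau_tau (S T : (E⁄F).Point) (f : L) : M.tau S (M.tau T f) = M.tau (S + T) f :=
  DFunLike.congr_fun (M.tau_comp S T) f

lemma tau_pull_nsmul {n : ℕ} (hn : ∀ S, n • M.gen ≠ M.const S) (S : (E⁄F).Point) (f : L) :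
    M.tau S (M.pull (n • M.gen) f) = M.pull (n • M.gen) (M.tau (n • S) f) := by
  have : (M.tau S).comp (M.pull (n • M.gen)) = (M.pull (n • M.gen)).comp (M.tau (n • S)) :=
    M.ext_of_map_gen <| by
      rw [← Point.map_map, ← Point.map_map, map_pull_gen _ hn, map_tau_gen, map_add,
        map_nsmul, map_tau_gen, map_pull_gen _ hn, map_const, nsmul_add, map_nsmul]
  exact DFunLike.congr_fun this f

/-- The divisor of a function, as a function on points (with value `0` for the zero function). -/
noncomputable def div (f : L) (S : (E⁄F).Point) : ℤ := -log (M.v (M.tau S f))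

lemma v_tau_ne_zero {f : L} (hf : f ≠ 0) (S : (E⁄F).Point) : M.v (M.tau S f) ≠ 0 := by
  rw [M.v.ne_zero_iff, Ne, map_eq_zero]; exact hf

lemma v_tau {f : L} (hf : f ≠ 0) (S : (E⁄F).Point) : M.v (M.tau S f) = exp (-M.div f S) := by
  rw [div, neg_neg, exp_log (M.v_tau_ne_zero hf S)]

lemma div_eq_iff {f : L} (hf : f ≠ 0) (S : (E⁄F).Point) (k : ℤ) :
    M.div f S = k ↔ M.v (M.tau S f) = exp (-k) := by
  rw [M.v_tau hf, exp_inj, neg_inj]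

lemma div_mul {f g : L} (hf : f ≠ 0) (hg : g ≠ 0) : M.div (f * g) = M.div f + M.div g := by
  ext S
  rw [div, map_mul, map_mul, log_mul (M.v_tau_ne_zero hf S) (M.v_tau_ne_zero hg S), Pi.add_apply,
    div, div, neg_add]

lemma div_inv (f : L) : M.div f⁻¹ = -M.div f := by
  ext S
  rw [div, map_inv₀, map_inv₀, log_inv, Pi.neg_apply, div]

lemma div_pow (f : L) (n : ℕ) : M.div (f ^ n) = n • M.div f := by
  ext S
  rw [div, map_pow, map_pow, log_pow, Pi.smul_apply, div, smul_neg]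

lemma div_const (c : F) : M.div (algebraMap F L c) = 0 := by
  ext S
  rw [div, AlgHom.commutes]
  by_cases hc : c = 0
  · simp [hc]
  · simp [M.v_const hc]

lemma div_tau (f : L) (S T : (E⁄F).Point) : M.div (M.tau T f) S = M.div f (S + T) := by
  rw [div, tau_tau, div]

lemma exists_semilinear (σ : F ≃ₐ[K] F) : ∃ φ : L →ₐ[K] L, Point.map φ M.gen = M.gen ∧
    ∀ c, φ (algebraMap F L c) = algebraMap F L (σ c) := by
  obtain ⟨φ, h1, h2, h3⟩ := M.exists_lift σ M.x M.y M.equation M.transcendental_x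
  refine ⟨φ, ?_, h3⟩
  rw [gen, Point.map_some, Point.some.injEq]
  exact ⟨h1, h2⟩

end points

end FunctionFieldModel

/-! ### Leading coefficients and primitive triples of polynomials. -/

section lead

variable {F : Type u} [Field F]

/-- The polynomial `p` has degree at most `d`, and `c` is its coefficient of degree `d`. -/
def HasLead (p : F[X]) (d : ℕ) (c : F) : Prop := p.natDegree ≤ d ∧ p.coeff d = c

namespace HasLead

variable {p q : F[X]} {d e : ℕ} {c c' : F}

lemma mul (hp : HasLead p d c) (hq : HasLead q e c') : HasLead (p * q) (d + e) (c * c') :=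
  ⟨natDegree_mul_le_of_le hp.1 hq.1, by
    rw [coeff_mul_add_eq_of_natDegree_le hp.1 hq.1, hp.2, hq.2]⟩

lemma add (hp : HasLead p d c) (hq : HasLead q d c') : HasLead (p + q) d (c + c') :=
  ⟨natDegree_add_le_of_degree_le hp.1 hq.1, by rw [coeff_add, hp.2, hq.2]⟩

lemma sub (hp : HasLead p d c) (hq : HasLead q d c') : HasLead (p - q) d (c - c') :=
  ⟨(natDegree_sub_le_of_le hp.1 hq.1).trans_eq (max_self d), by rw [coeff_sub, hp.2, hq.2]⟩

lemma C_mul (hp : HasLead p d c) (a : F) : HasLead (C a * p) d (a * c) :=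
  ⟨(natDegree_C_mul_le _ _).trans hp.1, by rw [coeff_C_mul, hp.2]⟩

lemma of_lt (hp : p.natDegree < d) : HasLead p d 0 := ⟨hp.le, coeff_eq_zero_of_natDegree_lt hp⟩

lemma mono (hp : HasLead p d c) (h : d < e) : HasLead p e 0 := of_lt (hp.1.trans_lt h)

lemma X : HasLead (X : F[X]) 1 1 := ⟨natDegree_X_le, coeff_X_one⟩

lemma monic (hp : HasLead p d 1) : p.Monic := monic_of_natDegree_le_of_coeff_eq_one d hp.1 hp.2

lemma natDegree_eq (hp : HasLead p d c) (hc : c ≠ 0) : p.natDegree = d :=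
  le_antisymm hp.1 (le_natDegree_of_ne_zero (hp.2 ▸ hc))

lemma of_mul_monic (hq : q.Monic) (h : HasLead (p * q) (d + q.natDegree) c) : HasLead p d c := by
  have h1 : p.natDegree ≤ d := by
    by_cases hp : p = 0
    · simp [hp]
    have := h.1
    rw [mul_comm, hq.natDegree_mul' hp] at this
    omega
  refine ⟨h1, ?_⟩
  rw [← h.2, coeff_mul_add_eq_of_natDegree_le h1 le_rfl, hq.coeff_natDegree, mul_one]

end HasLead

lemma exists_bezout_of_no_common_root [IsAlgClosed F] (u v w : F[X])
    (h : ∀ z, ¬ (u.eval z = 0 ∧ v.eval z = 0 ∧ w.eval z = 0)) :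
    ∃ a b c, a * u + b * v + c * w = 1 := by
  classical
  have hco : IsCoprime (EuclideanDomain.gcd u v) w := by
    rw [isCoprime_iff_aeval_ne_zero_of_isAlgClosed F F]
    intro z
    by_contra! hz
    have hu : u.eval z = 0 := by
      obtain ⟨r, hr⟩ := EuclideanDomain.gcd_dvd_left u v
      rw [hr, eval_mul]
      have := hz.1
      rw [coe_aeval_eq_eval] at this
      rw [this, zero_mul]
    have hv : v.eval z = 0 := by
      obtain ⟨r, hr⟩ := EuclideanDomain.gcd_dvd_right u v
      rw [hr, eval_mul]
      have := hz.1
      rw [coe_aeval_eq_eval] at this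
      rw [this, zero_mul]
    exact h z ⟨hu, hv, by simpa using hz.2⟩
  obtain ⟨a, b, hab⟩ := hco
  rw [EuclideanDomain.gcd_eq_gcd_ab] at hab
  exact ⟨a * EuclideanDomain.gcdA u v, a * EuclideanDomain.gcdB u v, b, by rw [← hab]; ring⟩

/-- Two proportional triples without common roots differ by a unit: a Bézout relation for each makes
`u₃` and `w₃` divide one another. -/
lemma exists_const_mul_eq [IsAlgClosed F] {u₁ u₂ u₃ w₁ w₂ w₃ : F[X]} (hu3 : u₃ ≠ 0) 
    (hu : ∀ z, ¬ (u₁.eval z = 0 ∧ u₂.eval z = 0 ∧ u₃.eval z = 0))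
    (hw : ∀ z, ¬ (w₁.eval z = 0 ∧ w₂.eval z = 0 ∧ w₃.eval z = 0))
    (h1 : u₁ * w₃ = w₁ * u₃) (h2 : u₂ * w₃ = w₂ * u₃) :
    ∃ c : F, c ≠ 0 ∧ w₁ = C c * u₁ ∧ w₂ = C c * u₂ ∧ w₃ = C c * u₃ := by
  obtain ⟨a, b, c, habc⟩ := exists_bezout_of_no_common_root _ _ _ hu
  obtain ⟨a', b', c', habc'⟩ := exists_bezout_of_no_common_root _ _ _ hw
  have hd : u₃ ∣ w₃ := ⟨a * w₁ + b * w₂ + c * w₃, by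
    linear_combination (-w₃) * habc + a * h1 + b * h2⟩
  have hd' : w₃ ∣ u₃ := ⟨a' * u₁ + b' * u₂ + c' * u₃, by
    linear_combination (-u₃) * habc' - a' * h1 - b' * h2⟩
  obtain ⟨r, hr⟩ := associated_of_dvd_dvd hd hd'
  obtain ⟨k, hk, hk'⟩ := Polynomial.isUnit_iff.mp r.isUnit
  have h3 : w₃ = C k * u₃ := by rw [← hr, hk', mul_comm]
  refine ⟨k, hk.ne_zero, mul_right_cancel₀ hu3 ?_, mul_right_cancel₀ hu3 ?_, h3⟩
  · rw [← h1, h3]; ring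
  · rw [← h2, h3]; ring

end lead

/-! ### The recursion for the `x`-coordinate of multiples of a point. -/

namespace WeierstrassCurve

section pair

variable {F : Type u} [Field F] (W : WeierstrassCurve F)

/-- A fraction `a / b` of polynomials in lowest terms with the degrees and leading coefficients of
the `x`-coordinate of the multiplication by `k + 1` on an elliptic curve. -/
structure IsMulPair (k : ℕ) (a b : F[X]) : Prop where
  -- The index is shifted to avoid subtraction: `k ^ 2 + 2 * k` is `(k + 1) ^ 2 - 1`. The second
  -- coefficient may vanish in `F`, and then the degree drops.
  lead_num : HasLead a ((k + 1) ^ 2) 1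
  lead_den : HasLead b (k ^ 2 + 2 * k) ((k + 1) ^ 2)
  isCoprime : IsCoprime a b

lemma IsMulPair.den_ne_zero {k : ℕ} {a b : F[X]} (h : IsMulPair k a b) : b ≠ 0 := by
  rintro rfl
  have h1 := isCoprime_zero_right.mp h.isCoprime
  have h2 := natDegree_eq_zero_of_isUnit h1
  rw [h.lead_num.natDegree_eq one_ne_zero] at h2
  exact (pow_ne_zero 2 (Nat.succ_ne_zero k)) h2

lemma IsMulPair.not_common_root {k : ℕ} {a b : F[X]} (h : IsMulPair k a b) (z : F)
    (ha : a.eval z = 0) : b.eval z ≠ 0 := by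
  intro hb
  obtain ⟨r, s, hrs⟩ := h.isCoprime
  have := congrArg (eval z) hrs
  simp [ha, hb] at this

/-- The numerator of `x(P + Q) x(P - Q)` for `s = x(P) x(Q)`, `t = x(P) + x(Q)`, homogenized. -/
noncomputable def prodNum {R : Type*} [CommRing R] [Algebra F R] (s t u : R) : R :=
  s ^ 2 - algebraMap F R W.b₄ * (s * u) - algebraMap F R W.b₆ * (t * u) -
    algebraMap F R W.b₈ * (u * u)

/-- The numerator of `x(P + Q) + x(P - Q)`, homogenized. -/
noncomputable def sumNum {R : Type*} [CommRing R] [Algebra F R] (s t u : R) : R :=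
  algebraMap F R 2 * (t * s) + algebraMap F R W.b₂ * (s * u) + algebraMap F R W.b₄ * (t * u) +
    algebraMap F R W.b₆ * (u * u)

/-- On an elliptic curve the map sending the symmetric functions of `x(P), x(Q)` to those of `x(P +
Q), x(P - Q)` has no base point. This excludes cancellation in the recursion. -/
lemma addSub_ne_zero [W.IsElliptic] {s t u : F} (h : ¬ (s = 0 ∧ t = 0 ∧ u = 0)) :
    ¬ (W.prodNum s t u = 0 ∧ W.sumNum s t u = 0 ∧ t ^ 2 - 4 * s * u = 0) := by
  rintro ⟨h1, h2, h3⟩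
  refine W.addSubMap_ne_zero (x := ![s, t, u]) ?_ ?_
  · intro h0
    exact h ⟨congrFun h0 0, congrFun h0 1, congrFun h0 2⟩
  · ext i
    fin_cases i
    · simp only [prodNum, Algebra.algebraMap_self, RingHom.id_apply] at h1
      simp [addSubMap]
      linear_combination h1
    · simp only [sumNum, Algebra.algebraMap_self, RingHom.id_apply] at h2
      simp [addSubMap]
      linear_combination h2
    · simp [addSubMap]
      linear_combination h3

lemma eval_prodNum (s t u : F[X]) (z : F) :
    (W.prodNum s t u).eval z = W.prodNum (s.eval z) (t.eval z) (u.eval z) := by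
  simp [prodNum, algebraMap_eq]

lemma eval_sumNum (s t u : F[X]) (z : F) :
    (W.sumNum s t u).eval z = W.sumNum (s.eval z) (t.eval z) (u.eval z) := by
  simp [sumNum, algebraMap_eq]

lemma IsMulPair.lead_add {k : ℕ} {a b : F[X]} (h : IsMulPair (k + 1) a b) :
    HasLead (a + b * X) ((k + 1 + 1) ^ 2) (1 + ((k : F) + 1 + 1) ^ 2) := by
  refine h.lead_num.add ?_
  convert! h.lead_den.mul HasLead.X using 1
  · ring
  · push_cast; ring

lemma IsMulPair.lead_prodNum {k : ℕ} {a b : F[X]} (h : IsMulPair (k + 1) a b) :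
    HasLead (W.prodNum (a * X) (a + b * X) b) (2 * (k + 2) ^ 2 + 2) 1 := by
  have hs := h.lead_num.mul HasLead.X
  have ht := h.lead_add
  have hu := h.lead_den
  have l1 : HasLead ((a * X) ^ 2) (2 * (k + 2) ^ 2 + 2) 1 := by
    rw [sq]; convert! hs.mul hs using 1
    · ring
    · ring
  have l2 := ((hs.mul hu).C_mul W.b₄).mono (e := 2 * (k + 2) ^ 2 + 2) (by nlinarith)
  have l3 := ((ht.mul hu).C_mul W.b₆).mono (e := 2 * (k + 2) ^ 2 + 2) (by nlinarith)
  have l4 := ((hu.mul hu).C_mul W.b₈).mono (e := 2 * (k + 2) ^ 2 + 2) (by nlinarith)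
  have l5 := ((l1.sub l2).sub l3).sub l4
  rw [sub_zero, sub_zero, sub_zero] at l5
  exact l5

lemma IsMulPair.lead_sumNum {k : ℕ} {a b : F[X]} (h : IsMulPair (k + 1) a b) :
    HasLead (W.sumNum (a * X) (a + b * X) b) (2 * (k + 2) ^ 2 + 1)
      (2 * (1 + ((k : F) + 2) ^ 2)) := by
  have hs := h.lead_num.mul HasLead.X
  have ht := h.lead_add
  have hu := h.lead_den
  have l1 : HasLead (C 2 * ((a + b * X) * (a * X))) (2 * (k + 2) ^ 2 + 1)
      (2 * (1 + ((k : F) + 2) ^ 2)) := by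
    convert! (ht.mul hs).C_mul 2 using 1
    · ring
    · ring
  have l2 := ((hs.mul hu).C_mul W.b₂).mono (e := 2 * (k + 2) ^ 2 + 1) (by nlinarith)
  have l3 := ((ht.mul hu).C_mul W.b₄).mono (e := 2 * (k + 2) ^ 2 + 1) (by nlinarith)
  have l4 := ((hu.mul hu).C_mul W.b₆).mono (e := 2 * (k + 2) ^ 2 + 1) (by nlinarith)
  have l5 := ((l1.add l2).add l3).add l4
  rw [add_zero, add_zero, add_zero] at l5
  exact l5

/-- With `m = k + 2`, the fractions `a₀/b₀`, `a/b`, `a'/b'` stand for `x` of `(m - 1)P`, `mP`, `(m +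
1)P`. The symmetric functions of the outer two, and those given by the addition formulas for `mP ±
P`, form proportional triples without common roots; they agree up to a constant, and degrees can be
read off. -/
lemma IsMulPair.succ [IsAlgClosed F] [W.IsElliptic] {k : ℕ} {a₀ b₀ a b a' b' : F[X]}
    (h₀ : IsMulPair k a₀ b₀) (h : IsMulPair (k + 1) a b) (h' : IsCoprime a' b') (hb' : b' ≠ 0)
    (h1 : a' * a₀ * (a - X * b) ^ 2 = W.prodNum (a * X) (a + b * X) b * (b' * b₀))
    (h2 : (a' * b₀ + b' * a₀) * (a - X * b) ^ 2 =
      W.sumNum (a * X) (a + b * X) b * (b' * b₀)) :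
    ∃ c : F, c ≠ 0 ∧ IsMulPair (k + 2) (C c * a') (C c * b') := by
  have hco (z : F) : ¬ (a'.eval z = 0 ∧ b'.eval z = 0) := by
    rintro ⟨ha, hb⟩
    obtain ⟨r, s, hrs⟩ := h'
    have := congrArg (eval z) hrs
    simp [ha, hb] at this
  obtain ⟨c, hc, e1, e2, e3⟩ := exists_const_mul_eq (u₁ := a' * a₀) (u₂ := a' * b₀ + b' * a₀)
    (u₃ := b' * b₀) (w₁ := W.prodNum (a * X) (a + b * X) b)
    (w₂ := W.sumNum (a * X) (a + b * X) b) (w₃ := (a - X * b) ^ 2)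
    (mul_ne_zero hb' h₀.den_ne_zero) (by
      intro z ⟨z1, z2, z3⟩
      have hz := h₀.not_common_root z
      have hz' := hco z
      simp only [eval_mul, eval_add, mul_eq_zero] at z1 z2 z3
      rcases z1 with z1 | z1
      · have : b'.eval z ≠ 0 := fun h ↦ hz' ⟨z1, h⟩
        have z4 : b₀.eval z = 0 := z3.resolve_left this
        rw [z1, zero_mul, zero_add, mul_eq_zero] at z2
        exact hz (z2.resolve_left this) z4
      · have z4 : b'.eval z = 0 := z3.resolve_right (hz z1)
        rw [z1, mul_zero, add_zero, mul_eq_zero] at z2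
        exact hz' ⟨z2.resolve_right (hz z1), z4⟩) (by
      intro z ⟨z1, z2, z3⟩
      rw [eval_prodNum] at z1
      rw [eval_sumNum] at z2
      refine W.addSub_ne_zero ?_ ⟨z1, z2, ?_⟩
      · rintro ⟨s1, s2, s3⟩
        simp only [eval_add, eval_mul, s3, zero_mul, add_zero] at s2
        exact h.not_common_root z s2 s3
      · simp only [eval_pow, eval_sub, eval_mul, eval_add, eval_X] at z3 ⊢
        linear_combination z3) h1 h2
  have hA := h.lead_prodNum W
  have hB := h.lead_sumNum W
  have hm₀ := h₀.lead_num.monic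
  have hd₀ := h₀.lead_num.natDegree_eq one_ne_zero
  have ha' : HasLead (C c * a') ((k + 2 + 1) ^ 2) 1 := by
    refine HasLead.of_mul_monic hm₀ ?_
    rw [hd₀, mul_assoc, ← e1]
    convert! hA using 1
    ring
  refine ⟨c, hc, ha', ?_, ?_⟩
  · refine HasLead.of_mul_monic hm₀ ?_
    -- The relation for `b' * b₀` does not suffice, as the expected leading coefficient of `b₀` may
    -- vanish in `F`. The sum formula divides by the monic `a₀` instead: `2(1 + (k+2)²) - (k+1)² =
    -- (k+3)²`.
    have : C c * b' * a₀ = W.sumNum (a * X) (a + b * X) b - C c * a' * b₀ := by rw [e2]; ring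
    have hQ : HasLead (C c * a' * b₀) (2 * (k + 2) ^ 2 + 1) (((k : F) + 1) ^ 2) := by
      convert! ha'.mul h₀.lead_den using 1
      · ring
      · ring
    rw [hd₀, this]
    convert! hB.sub hQ using 1
    · ring
    · push_cast; ring
  · have hcu : IsUnit (C c) := isUnit_C.mpr (isUnit_iff_ne_zero.mpr hc)
    exact (isCoprime_mul_unit_left_left hcu _ _).mpr ((isCoprime_mul_unit_left_right hcu _ _).mpr h')

variable (F) in
lemma isMulPair_zero : IsMulPair 0 (X : F[X]) 1 :=
  ⟨by simpa using HasLead.X, by simp [HasLead], isCoprime_one_right⟩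

lemma isMulPair_one [IsAlgClosed F] [W.IsElliptic] : IsMulPair 1
    (X ^ 4 - C W.b₄ * X ^ 2 - C (2 * W.b₆) * X - C W.b₈)
    (C 4 * X ^ 3 + C W.b₂ * X ^ 2 + C (2 * W.b₄) * X + C W.b₆) := by
  refine ⟨⟨?_, ?_⟩, ⟨?_, ?_⟩, ?_⟩
  · norm_num; compute_degree!
  · norm_num
  · norm_num; compute_degree!
  · norm_num
  · rw [isCoprime_iff_aeval_ne_zero_of_isAlgClosed F F]
    intro z
    by_contra! hz
    -- These are the symmetric functions of the pair `z, z`: duplication is the case `P = Q`, where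
    -- the third form vanishes identically.
    refine W.addSub_ne_zero (s := z ^ 2) (t := 2 * z) (u := 1) (by simp) ⟨?_, ?_, by ring⟩
    · rw [← hz.1]; simp [prodNum]
      try ring
    · rw [← hz.2]; simp [sumNum]
      try ring

end pair

namespace Affine.Point

variable {L : Type w} [Field L] [DecidableEq L] {V : Affine L}

lemma add_sub_some {x₁ y₁ x₂ y₂ : L} (h₁ : V.Nonsingular x₁ y₁) (h₂ : V.Nonsingular x₂ y₂)
    (hx : x₁ ≠ x₂) : ∃ x₃ y₃ h₃ x₄ y₄ h₄, some x₁ y₁ h₁ + some x₂ y₂ h₂ = some x₃ y₃ h₃ ∧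
      some x₁ y₁ h₁ - some x₂ y₂ h₂ = some x₄ y₄ h₄ ∧
      (x₃ + x₄) * (x₁ - x₂) ^ 2 = 2 * ((x₁ + x₂) * (x₁ * x₂)) + V.b₂ * (x₁ * x₂) +
        V.b₄ * (x₁ + x₂) + V.b₆ ∧
      x₃ * x₄ * (x₁ - x₂) ^ 2 = (x₁ * x₂) ^ 2 - V.b₄ * (x₁ * x₂) - V.b₆ * (x₁ + x₂) - V.b₈ := by
  have e₁ := (V.equation_iff _ _).mp h₁.1
  have e₂ := (V.equation_iff _ _).mp h₂.1
  have hd : x₁ - x₂ ≠ 0 := sub_ne_zero.mpr hx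
  have h₂' := (nonsingular_neg ..).mpr h₂
  have l₁ : V.slope x₁ x₂ y₁ y₂ * (x₁ - x₂) = y₁ - y₂ := by
    rw [slope_of_X_ne hx, div_mul_cancel₀ _ hd]
  have l₂ : V.slope x₁ x₂ y₁ (V.negY x₂ y₂) * (x₁ - x₂) = y₁ + y₂ + V.a₁ * x₂ + V.a₃ := by
    rw [slope_of_X_ne hx, div_mul_cancel₀ _ hd, negY]; ring
  refine ⟨_, _, nonsingular_add h₁ h₂ fun hxy => hx hxy.left, _, _,
    nonsingular_add h₁ h₂' fun hxy => hx hxy.left, add_of_X_ne hx,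
    by rw [sub_eq_add_neg, neg_some, add_of_X_ne hx], ?_, ?_⟩
  · rw [addX, addX, b₂, b₄, b₆]
    set s := V.slope x₁ x₂ y₁ y₂
    set t := V.slope x₁ x₂ y₁ (V.negY x₂ y₂)
    linear_combination 2 * e₁ + 2 * e₂ + (s * (x₁ - x₂) + (y₁ - y₂) + V.a₁ * (x₁ - x₂)) * l₁ +
      (t * (x₁ - x₂) + (y₁ + y₂ + V.a₁ * x₂ + V.a₃) + V.a₁ * (x₁ - x₂)) * l₂
  · rw [addX, addX]
    set s := V.slope x₁ x₂ y₁ y₂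
    set t := V.slope x₁ x₂ y₁ (V.negY x₂ y₂)
    have m₁ : (s ^ 2 + V.a₁ * s - V.a₂ - x₁ - x₂) * (x₁ - x₂) ^ 2 = (y₁ - y₂) ^ 2 +
        V.a₁ * (y₁ - y₂) * (x₁ - x₂) - (V.a₂ + x₁ + x₂) * (x₁ - x₂) ^ 2 := by
      linear_combination (s * (x₁ - x₂) + (y₁ - y₂) + V.a₁ * (x₁ - x₂)) * l₁
    have m₂ : (t ^ 2 + V.a₁ * t - V.a₂ - x₁ - x₂) * (x₁ - x₂) ^ 2 =
        (y₁ + y₂ + V.a₁ * x₂ + V.a₃) ^ 2 + V.a₁ * (y₁ + y₂ + V.a₁ * x₂ + V.a₃) * (x₁ - x₂) -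
          (V.a₂ + x₁ + x₂) * (x₁ - x₂) ^ 2 := by
      linear_combination
        (t * (x₁ - x₂) + (y₁ + y₂ + V.a₁ * x₂ + V.a₃) + V.a₁ * (x₁ - x₂)) * l₂
    refine mul_right_cancel₀ (pow_ne_zero 2 hd) (Eq.trans ?_ (Eq.trans (congrArg₂ (· * ·) m₁ m₂) ?_))
    · ring
    · rw [b₄, b₆, b₈]
      clear_value s t
      clear m₁ m₂ l₁ l₂ hd
      generalize V.a₁ = A1 at *
      generalize V.a₂ = A2 at *
      generalize V.a₃ = A3 at *
      generalize V.a₄ = A4 at *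
      generalize V.a₆ = A6 at *
      clear h₁ h₂ h₂' hx
      grind

lemma two_nsmul_some {x y : L} (h : V.Nonsingular x y) (hy : 2 * y + V.a₁ * x + V.a₃ ≠ 0) :
    ∃ x' y' h', 2 • some x y h = some x' y' h' ∧
      x' * (4 * x ^ 3 + V.b₂ * x ^ 2 + 2 * V.b₄ * x + V.b₆) =
        x ^ 4 - V.b₄ * x ^ 2 - 2 * V.b₆ * x - V.b₈ := by
  have hy' : y ≠ V.negY x y := by
    rw [negY]; intro h; apply hy; linear_combination h
  refine ⟨_, _, nonsingular_add h h fun hxy ↦ hy' hxy.right,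
    (two_nsmul _).trans (add_self_of_Y_ne hy'), ?_⟩
  have e := (V.equation_iff _ _).mp h.1
  have hl : V.slope x x y y * (2 * y + V.a₁ * x + V.a₃) =
      3 * x ^ 2 + 2 * V.a₂ * x + V.a₄ - V.a₁ * y := by
    rw [slope_of_Y_ne rfl hy', negY,
      show y - (-y - V.a₁ * x - V.a₃) = 2 * y + V.a₁ * x + V.a₃ by ring, div_mul_cancel₀ _ hy]
  have hD : 4 * x ^ 3 + V.b₂ * x ^ 2 + 2 * V.b₄ * x + V.b₆ = (2 * y + V.a₁ * x + V.a₃) ^ 2 := by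
    rw [b₂, b₄, b₆]; linear_combination -4 * e
  have hm : (V.slope x x y y ^ 2 + V.a₁ * V.slope x x y y - V.a₂ - x - x) *
      (2 * y + V.a₁ * x + V.a₃) ^ 2 = (3 * x ^ 2 + 2 * V.a₂ * x + V.a₄ - V.a₁ * y) ^ 2 +
      V.a₁ * (3 * x ^ 2 + 2 * V.a₂ * x + V.a₄ - V.a₁ * y) * (2 * y + V.a₁ * x + V.a₃) -
      (V.a₂ + x + x) * (2 * y + V.a₁ * x + V.a₃) ^ 2 := by
    linear_combination (V.slope x x y y * (2 * y + V.a₁ * x + V.a₃) +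
      (3 * x ^ 2 + 2 * V.a₂ * x + V.a₄ - V.a₁ * y) +
      V.a₁ * (2 * y + V.a₁ * x + V.a₃)) * hl
  rw [addX, hD, hm, b₄, b₆, b₈]
  linear_combination -(V.a₁ ^ 2 + 4 * V.a₂ + 8 * x) * e

end Affine.Point

end WeierstrassCurve

/-! ### Multiplication by `n` on the generic point. -/

namespace FunctionFieldModel

open WeierstrassCurve WeierstrassCurve.Affine

section multiplication

variable {K : Type u} [Field K] {E : WeierstrassCurve K} {F : Type v} {L : Type w} [Field F]
  [Field L] [Algebra K F] [Algebra F L] [Algebra K L] [IsScalarTower K F L]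
  (M : FunctionFieldModel E F L) [E.IsElliptic] [DecidableEq F] [DecidableEq L] [IsAlgClosed F]

instance : (E⁄F).IsElliptic := inferInstanceAs (E.map (algebraMap K F)).IsElliptic

variable (E F L) in
lemma baseChange_eq_map : E⁄L = (E⁄F).map (algebraMap F L) := by
  change E.map _ = (E.map _).map _
  rw [WeierstrassCurve.map_map, ← IsScalarTower.algebraMap_eq]

lemma aeval_prodNum (W : WeierstrassCurve F) (a : L) (s t u : F[X]) :
    aeval a (W.prodNum s t u) = W.prodNum (aeval a s) (aeval a t) (aeval a u) := by
  simp [prodNum, -algebraMap_eq]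

lemma aeval_sumNum (W : WeierstrassCurve F) (a : L) (s t u : F[X]) :
    aeval a (W.sumNum s t u) = W.sumNum (aeval a s) (aeval a t) (aeval a u) := by
  simp only [sumNum, map_add, map_mul, AlgHom.commutes]

lemma exists_isMulPair_zero : ∃ a b : F[X], IsMulPair 0 a b ∧ ∃ u v h,
    (0 + 1) • M.gen = .some u v h ∧ u * aeval M.x b = aeval M.x a :=
  ⟨_, _, isMulPair_zero F, _, _, _, one_nsmul _, by simp⟩

lemma exists_isMulPair_one : ∃ a b : F[X], IsMulPair 1 a b ∧ ∃ u v h,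
    (1 + 1) • M.gen = .some u v h ∧ u * aeval M.x b = aeval M.x a := by
  have h := isMulPair_one (E⁄F)
  have e := (WeierstrassCurve.Affine.equation_iff ..).mp M.equation
  have hy : 2 * M.y + (E⁄L).a₁ * M.x + (E⁄L).a₃ ≠ 0 := by
    intro h0
    refine M.aeval_x_eq_zero.not.mpr h.den_ne_zero ?_
    have : aeval M.x (C 4 * X ^ 3 + C (E⁄F).b₂ * X ^ 2 + C (2 * (E⁄F).b₄) * X + C (E⁄F).b₆) =
        4 * M.x ^ 3 + (E⁄L).b₂ * M.x ^ 2 + 2 * (E⁄L).b₄ * M.x + (E⁄L).b₆ := by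
      rw [baseChange_eq_map E F L, map_b₂, map_b₄, map_b₆]
      simp [map_ofNat (algebraMap F L)]
    rw [this, b₂, b₄, b₆]
    linear_combination (2 * M.y + (E⁄L).a₁ * M.x + (E⁄L).a₃) * h0 - 4 * e
  obtain ⟨u, v, h', h1, h2⟩ := Point.two_nsmul_some (equation_iff_nonsingular.mp M.equation) hy
  refine ⟨_, _, h, u, v, h', h1, ?_⟩
  rw [baseChange_eq_map E F L, map_b₂, map_b₄, map_b₆, map_b₈] at h2
  simpa [map_ofNat (algebraMap F L)] using h2

lemma exists_isMulPair_add_two {k : ℕ} (hk : ∃ a b : F[X], IsMulPair k a b ∧ ∃ u v h,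
      (k + 1) • M.gen = .some u v h ∧ u * aeval M.x b = aeval M.x a)
    (hk' : ∃ a b : F[X], IsMulPair (k + 1) a b ∧ ∃ u v h,
      (k + 1 + 1) • M.gen = .some u v h ∧ u * aeval M.x b = aeval M.x a) :
    ∃ a b : F[X], IsMulPair (k + 2) a b ∧ ∃ u v h,
      (k + 2 + 1) • M.gen = .some u v h ∧ u * aeval M.x b = aeval M.x a := by
  classical
  obtain ⟨a₀, b₀, hp₀, u₀, v₀, h₀, hg₀, hu₀⟩ := hk
  obtain ⟨a, b, hp, u, v, h, hg, hu⟩ := hk'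
  have hb : aeval M.x b ≠ 0 := M.aeval_x_eq_zero.not.mpr hp.den_ne_zero
  have hb₀ : aeval M.x b₀ ≠ 0 := M.aeval_x_eq_zero.not.mpr hp₀.den_ne_zero
  -- If `a = X b`, coprimality makes `b` a unit, so `a` has degree `1`, whereas its degree is a
  -- square at least `4`.
  have hd : a - X * b ≠ 0 := by
    intro h0
    have hd : b ∣ a := ⟨X, by linear_combination h0⟩
    have hunit : IsUnit b := hp.isCoprime.symm.isUnit_of_dvd' dvd_rfl hd
    obtain ⟨c, hc, hc'⟩ := Polynomial.isUnit_iff.mp hunit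
    have h1 := hp.lead_num.natDegree_eq one_ne_zero
    rw [sub_eq_zero.mp h0, ← hc', mul_comm, natDegree_C_mul hc.ne_zero, natDegree_X] at h1
    have : 2 ^ 2 ≤ (k + 1 + 1) ^ 2 := Nat.pow_le_pow_left (by omega) 2
    omega
  have hd' := M.aeval_x_eq_zero.not.mpr hd
  have hux : u ≠ M.x := by
    rintro rfl
    apply hd'
    simp only [map_sub, map_mul, aeval_X]
    linear_combination -hu
  obtain ⟨u₃, v₃, h₃, u₄, v₄, h₄, e₃, e₄, hs, hm⟩ :=
    Point.add_sub_some h (equation_iff_nonsingular.mp M.equation) hux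
  have hsub : u₄ = u₀ := by
    have : Point.some u v h - M.gen = Point.some u₀ v₀ h₀ := by
      rw [← hg, ← hg₀, succ_nsmul _ (k + 1), add_sub_cancel_right]
    have := e₄.symm.trans this
    rw [Point.some.injEq] at this
    exact this.1
  subst hsub
  have hadd : (k + 2 + 1) • M.gen = Point.some u₃ v₃ h₃ := by
    rw [succ_nsmul, hg]; exact e₃
  rw [baseChange_eq_map E F L, map_b₄, map_b₆] at hs hm
  rw [map_b₂] at hs
  rw [map_b₈] at hm
  have hS : (u₃ + u₄) * aeval M.x (a - X * b) ^ 2 =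
      aeval M.x ((E⁄F).sumNum (a * X) (a + b * X) b) := by
    rw [aeval_sumNum, sumNum]
    simp only [map_sub, map_add, map_mul, aeval_X, map_ofNat, ← hu]
    linear_combination aeval M.x b ^ 2 * hs
  have hP : u₃ * u₄ * aeval M.x (a - X * b) ^ 2 =
      aeval M.x ((E⁄F).prodNum (a * X) (a + b * X) b) := by
    rw [aeval_prodNum, prodNum]
    simp only [map_sub, map_add, map_mul, aeval_X, ← hu]
    linear_combination aeval M.x b ^ 2 * hm
  set S := (E⁄F).sumNum (a * X) (a + b * X) b with hSdef
  set P := (E⁄F).prodNum (a * X) (a + b * X) b with hPdef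
  -- The sum formula gives `u₃ = S / (a - X b)² - a₀ / b₀`; this fraction is then reduced by its
  -- gcd.
  set num := S * b₀ - a₀ * (a - X * b) ^ 2 with hnum
  set den := b₀ * (a - X * b) ^ 2 with hden
  have hden0 : den ≠ 0 := mul_ne_zero hp₀.den_ne_zero (pow_ne_zero 2 hd)
  have hu₃ : u₃ * aeval M.x den = aeval M.x num := by
    rw [hnum, hden]
    simp only [map_sub _ (_ * b₀), map_mul _ b₀, map_mul _ a₀, map_mul _ S, map_pow, ← hS, ← hu₀]
    ring
  have hgcd : EuclideanDomain.gcd num den ≠ 0 := fun h ↦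
    hden0 (EuclideanDomain.gcd_eq_zero_iff.mp h).2
  obtain ⟨a', ha'⟩ := EuclideanDomain.gcd_dvd_left num den
  obtain ⟨b', hb'⟩ := EuclideanDomain.gcd_dvd_right num den
  have hco : IsCoprime a' b' := by
    have := EuclideanDomain.gcd_eq_gcd_ab num den
    refine ⟨EuclideanDomain.gcdA num den, EuclideanDomain.gcdB num den,
      mul_left_cancel₀ hgcd ?_⟩
    conv_rhs => rw [mul_one, this]
    linear_combination (-EuclideanDomain.gcdA num den) * ha' - EuclideanDomain.gcdB num den * hb'
  have hb'0 : b' ≠ 0 := by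
    rintro rfl
    exact hden0 (by rw [hb', mul_zero])
  have hu' : u₃ * aeval M.x b' = aeval M.x a' := by
    refine mul_left_cancel₀ (M.aeval_x_eq_zero.not.mpr hgcd) ?_
    rw [← map_mul _ _ a', ← ha', ← hu₃]
    conv_rhs => rw [hb', map_mul]
    ring
  obtain ⟨c, hc, hpair⟩ := IsMulPair.succ (E⁄F) hp₀ hp hco hb'0
    (M.aeval_x_inj.mp (by
      rw [map_mul _ (_ * _), map_mul _ _ (_ * _), map_pow, ← hP, map_mul, map_mul, ← hu', ← hu₀]
      ring))
    (M.aeval_x_inj.mp (by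
      rw [map_mul _ (_ + _), map_mul _ _ (_ * _), map_pow, ← hS, map_add, map_mul, map_mul,
        map_mul, ← hu', ← hu₀]
      ring))
  refine ⟨_, _, hpair, u₃, v₃, h₃, hadd, ?_⟩
  rw [map_mul, map_mul, ← hu']
  ring

lemma exists_isMulPair (k : ℕ) : ∃ a b : F[X], IsMulPair k a b ∧ ∃ u v h,
    (k + 1) • M.gen = .some u v h ∧ u * aeval M.x b = aeval M.x a := by
  have : (∃ a b : F[X], IsMulPair k a b ∧ ∃ u v h,
      (k + 1) • M.gen = .some u v h ∧ u * aeval M.x b = aeval M.x a) ∧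
      (∃ a b : F[X], IsMulPair (k + 1) a b ∧ ∃ u v h,
      (k + 1 + 1) • M.gen = .some u v h ∧ u * aeval M.x b = aeval M.x a) := by
    induction k with
    | zero => exact ⟨M.exists_isMulPair_zero, M.exists_isMulPair_one⟩
    | succ k ih => exact ⟨ih.2, M.exists_isMulPair_add_two ih.1 ih.2⟩
  exact this.1

variable {n : ℕ}

lemma exists_nsmul_gen (hn : 0 < n) : ∃ a b : F[X], a.Monic ∧ a.natDegree = n ^ 2 ∧
    b.natDegree < n ^ 2 ∧ ((n : F) ≠ 0 → b.natDegree + 1 = n ^ 2) ∧ IsCoprime a b ∧ b ≠ 0 ∧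
    ∃ u v h, n • M.gen = .some u v h ∧ u * aeval M.x b = aeval M.x a := by
  obtain ⟨k, rfl⟩ := Nat.exists_eq_succ_of_ne_zero hn.ne'
  obtain ⟨a, b, h, hP⟩ := M.exists_isMulPair k
  have e : (k + 1) ^ 2 = k ^ 2 + 2 * k + 1 := by ring
  refine ⟨a, b, h.lead_num.monic, h.lead_num.natDegree_eq one_ne_zero, ?_, fun h0 ↦ ?_,
    h.isCoprime, h.den_ne_zero, hP⟩
  · exact (h.lead_den.1.trans_lt (Nat.lt_succ_self _)).trans_eq e.symm
  · rw [h.lead_den.natDegree_eq (pow_ne_zero 2 (by exact_mod_cast h0)), Nat.succ_eq_add_one, e]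

lemma exists_v_nsmul_gen (hn : 0 < n) : ∃ e : ℕ, 0 < e ∧ ((n : F) ≠ 0 → e = 1) ∧
    ∃ u v h, n • M.gen = .some u v h ∧ M.v u = exp (2 * e : ℤ) := by
  obtain ⟨a, b, ha, had, hbd, hbd', -, hb, u, v, h, hg, hu⟩ := M.exists_nsmul_gen hn
  -- This difference of degrees is the ramification index of `[n]` at the origin; it is `1` when `n`
  -- is invertible.
  refine ⟨n ^ 2 - b.natDegree, by omega, fun h0 ↦ by have := hbd' h0; omega, u, v, h, hg, ?_⟩
  have h1 := congrArg M.v hu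
  rw [map_mul, M.v_aeval hb, M.v_aeval ha.ne_zero] at h1
  refine mul_right_cancel₀ (exp_ne_zero (a := (2 * b.natDegree : ℤ))) ?_
  rw [h1, ← exp_add, had]
  congr 1
  push_cast [Nat.cast_sub hbd.le]
  ring

lemma nsmul_gen_ne_const (hn : 0 < n) (S : (E⁄F).Point) : n • M.gen ≠ M.const S := by
  obtain ⟨e, he, -, u, v, h, hg, hu⟩ := M.exists_v_nsmul_gen hn
  rw [hg]
  cases S with
  | zero => rw [← Point.zero_def, map_zero]; exact Point.some_ne_zero h
  | some a b hab =>
    obtain ⟨h', h''⟩ := M.const_some hab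
    rw [h'', Ne, Point.some.injEq]
    rintro ⟨rfl, -⟩
    have := val_algebraMap_le_one M.v a
    rw [hu, ← exp_zero, exp_le_exp] at this
    omega

/-- The pullback of functions along multiplication by `n`. -/
noncomputable abbrev mulPull (n : ℕ) : L →ₐ[F] L := M.pull (n • M.gen)

lemma tau_mulPull (hn : 0 < n) (S : (E⁄F).Point) (f : L) :
    M.tau S (M.mulPull n f) = M.mulPull n (M.tau (n • S) f) :=
  M.tau_pull_nsmul (M.nsmul_gen_ne_const hn) S f

lemma exists_mulPull_x (hn : 0 < n) : ∃ a b : F[X], a.Monic ∧ a.natDegree = n ^ 2 ∧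
    b.natDegree < n ^ 2 ∧ ((n : F) ≠ 0 → b.natDegree + 1 = n ^ 2) ∧ IsCoprime a b ∧ b ≠ 0 ∧
    M.mulPull n M.x * aeval M.x b = aeval M.x a := by
  obtain ⟨a, b, ha, had, hbd, hbd', hab, hb, u, v, h, hg, hu⟩ := M.exists_nsmul_gen hn
  have h1 := M.map_pull_gen (M.nsmul_gen_ne_const hn)
  conv_rhs at h1 => rw [hg]
  rw [gen, Point.map_some, Point.some.injEq] at h1
  exact ⟨a, b, ha, had, hbd, hbd', hab, hb, by rw [← hu, ← h1.1]; rfl⟩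

instance comap_isTrivialOn (w : Valuation L ℤᵐ⁰) [w.IsTrivialOn F] (φ : L →ₐ[F] L) :
    (w.comap (φ : L →+* L)).IsTrivialOn F :=
  ⟨fun c hc ↦ by simpa using Valuation.IsTrivialOn.eq_one (v := w) c hc⟩

lemma exists_v_mulPull (hn : 0 < n) : ∃ e : ℕ, 0 < e ∧ ((n : F) ≠ 0 → e = 1) ∧
    ∀ f, M.v (M.mulPull n f) = M.v f ^ e := by
  obtain ⟨e, he, he1, u, v, h, hg, hu⟩ := M.exists_v_nsmul_gen hn
  refine ⟨e, he, he1, M.val_eq_pow (w := M.v.comap (M.mulPull n : L →+* L)) he ?_⟩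
  have h1 := M.map_pull_gen (M.nsmul_gen_ne_const hn)
  conv_rhs at h1 => rw [hg]
  rw [gen, Point.map_some, Point.some.injEq] at h1
  rw [← hu, ← h1.1]
  rfl

lemma v_mulPull (hn : (n : F) ≠ 0) (f : L) : M.v (M.mulPull n f) = M.v f := by
  have h0 : 0 < n := Nat.pos_of_ne_zero (by rintro rfl; simp at hn)
  obtain ⟨e, -, he, h⟩ := M.exists_v_mulPull h0
  rw [h, he hn, pow_one]

end multiplication
end FunctionFieldModel

/-! ### Local behaviour at affine points, and regular functions. -/

namespace FunctionFieldModel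

open WeierstrassCurve WeierstrassCurve.Affine

section regular

variable {K : Type u} [Field K] {E : WeierstrassCurve K} {F : Type v} {L : Type w} [Field F]
  [Field L] [Algebra K F] [Algebra F L] [Algebra K L] [IsScalarTower K F L]
  (M : FunctionFieldModel E F L) [E.IsElliptic] [DecidableEq F] [DecidableEq L] [IsAlgClosed F]

variable {a b : F}

/-- The addition law with denominators cleared. The two terms on the right have pole orders at most
`2` and `3`, against order `4` for the square on the left; so `x - a` vanishes at `(a, b)` to order
`1`, or to order `2` where the tangent is vertical. -/
lemma tau_x_sub_mul (h : (E⁄F).Nonsingular a b) :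
    (M.tau (.some a b h) M.x - algebraMap F L a) * (M.x - algebraMap F L a) ^ 2 =
      algebraMap F L (3 * a ^ 2 + 2 * (E⁄F).a₂ * a + (E⁄F).a₄ - (E⁄F).a₁ * b) *
        (M.x - algebraMap F L a) -
      algebraMap F L (2 * b + (E⁄F).a₁ * a + (E⁄F).a₃) * (M.y - algebraMap F L b) := by
  have h1 := M.map_tau_gen (.some a b h)
  obtain ⟨h', h''⟩ := M.const_some h
  have hx : M.x - algebraMap F L a ≠ 0 := sub_ne_zero.mpr (M.x_ne_const a)
  rw [h'', gen, Point.add_of_X_ne (M.x_ne_const a), Point.map_some, Point.some.injEq] at h1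
  have h2 := h1.1
  rw [addX, slope_of_X_ne (M.x_ne_const a)] at h2
  have e₁ := (equation_iff (F := F)).mp M.equation
  have e₂ := (equation_iff (F := F)).mp h'.1
  rw [baseChange_eq_map E F L, map_a₁, map_a₂] at h2
  rw [h2]
  simp only [map_add, map_sub, map_mul, map_pow, map_ofNat]
  field_simp
  linear_combination e₁ - e₂

lemma v_x_sub (c : F) : M.v (M.x - algebraMap F L c) = exp 2 := by
  have := M.v_aeval (X_sub_C_ne_zero c)
  simpa using this

lemma v_y_sub (c : F) : M.v (M.y - algebraMap F L c) = exp 3 := by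
  rw [M.v.map_sub_eq_of_lt_left, M.v_y]
  refine (val_algebraMap_le_one M.v c).trans_lt ?_
  rw [M.v_y, ← exp_zero, exp_lt_exp]; norm_num

lemma v_tau_x_sub_of_ne (h : (E⁄F).Nonsingular a b)
    (hb : 2 * b + (E⁄F).a₁ * a + (E⁄F).a₃ ≠ 0) :
    M.v (M.tau (.some a b h) M.x - algebraMap F L a) = exp (-1) := by
  have h1 := congrArg M.v (M.tau_x_sub_mul h)
  rw [M.v.map_sub_eq_of_lt_right, map_mul, map_pow, map_mul, M.v_const hb, one_mul, M.v_y_sub,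
    M.v_x_sub] at h1
  · refine mul_right_cancel₀ (pow_ne_zero 2 (exp_ne_zero (a := (2 : ℤ)))) ?_
    rw [h1, ← exp_nsmul, ← exp_add]
    rfl
  · rw [map_mul, map_mul, M.v_const hb, one_mul, M.v_y_sub, M.v_x_sub]
    refine (mul_le_of_le_one_left' (val_algebraMap_le_one M.v _)).trans_lt ?_
    rw [exp_lt_exp]; norm_num

lemma v_tau_x_sub_of_eq (h : (E⁄F).Nonsingular a b)
    (hb : 2 * b + (E⁄F).a₁ * a + (E⁄F).a₃ = 0) :
    M.v (M.tau (.some a b h) M.x - algebraMap F L a) = exp (-2) := by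
  have hl : 3 * a ^ 2 + 2 * (E⁄F).a₂ * a + (E⁄F).a₄ - (E⁄F).a₁ * b ≠ 0 := by
    rcases ((nonsingular_iff ..).mp h).2 with h1 | h1
    · intro h2; apply h1; linear_combination -h2
    · exact fun _ ↦ h1 (by linear_combination hb)
  have h1 := congrArg M.v (M.tau_x_sub_mul h)
  rw [hb, map_zero, zero_mul, sub_zero, map_mul, map_pow, map_mul, M.v_const hl, one_mul,
    M.v_x_sub] at h1
  refine mul_right_cancel₀ (pow_ne_zero 2 (exp_ne_zero (a := (2 : ℤ)))) ?_
  rw [h1, ← exp_nsmul, ← exp_add]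
  rfl

lemma v_tau_x_sub_lt_one (h : (E⁄F).Nonsingular a b) :
    M.v (M.tau (.some a b h) M.x - algebraMap F L a) < 1 := by
  by_cases hb : 2 * b + (E⁄F).a₁ * a + (E⁄F).a₃ = 0
  · rw [M.v_tau_x_sub_of_eq h hb, ← exp_zero, exp_lt_exp]; norm_num
  · rw [M.v_tau_x_sub_of_ne h hb, ← exp_zero, exp_lt_exp]; norm_num

lemma v_tau_x_le_one (h : (E⁄F).Nonsingular a b) : M.v (M.tau (.some a b h) M.x) ≤ 1 := by
  have := M.v.map_add_le (M.v_tau_x_sub_lt_one h).le (val_algebraMap_le_one M.v a)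
  rwa [sub_add_cancel] at this

lemma tau_equation (S : (E⁄F).Point) : M.tau S M.y ^ 2 +
    algebraMap F L (E⁄F).a₁ * M.tau S M.x * M.tau S M.y + algebraMap F L (E⁄F).a₃ * M.tau S M.y =
      M.tau S M.x ^ 3 + algebraMap F L (E⁄F).a₂ * M.tau S M.x ^ 2 +
        algebraMap F L (E⁄F).a₄ * M.tau S M.x + algebraMap F L (E⁄F).a₆ := by
  have := congrArg (M.tau S) ((equation_iff (F := F)).mp M.equation)
  simpa only [map_add, map_mul, map_pow, AlgHom.commutes] using this

lemma tau_equation_sub (h : (E⁄F).Nonsingular a b) {u v : L}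
    (hu : u = M.tau (.some a b h) M.x - algebraMap F L a)
    (hv : v = M.tau (.some a b h) M.y - algebraMap F L b) :
    v * (v + (algebraMap F L (E⁄F).a₁ * u +
      algebraMap F L (2 * b + (E⁄F).a₁ * a + (E⁄F).a₃))) =
    u * (u ^ 2 + algebraMap F L (3 * a + (E⁄F).a₂) * u +
      algebraMap F L (3 * a ^ 2 + 2 * (E⁄F).a₂ * a + (E⁄F).a₄ - (E⁄F).a₁ * b)) := by
  obtain ⟨h', h''⟩ := M.const_some h
  have e₂ := (equation_iff (F := F)).mp h'.1
  have e₁ := M.tau_equation (.some a b h)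
  subst hu hv
  simp only [map_add, map_sub, map_mul, map_pow, map_ofNat]
  linear_combination e₁ - e₂

lemma v_tau_y_le_one (h : (E⁄F).Nonsingular a b) : M.v (M.tau (.some a b h) M.y) ≤ 1 := by
  by_contra! h1
  have hx := M.v_tau_x_le_one h
  have e := M.tau_equation (.some a b h)
  set u := M.tau (.some a b h) M.x
  set v := M.tau (.some a b h) M.y
  have e' : v * (v + aeval u (C (E⁄F).a₁ * X + C (E⁄F).a₃)) =
      aeval u (X ^ 3 + C (E⁄F).a₂ * X ^ 2 + C (E⁄F).a₄ * X + C (E⁄F).a₆) := by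
    simp only [map_add, map_mul, map_pow, aeval_C, aeval_X]
    linear_combination e
  have h2 := congrArg M.v e'
  rw [map_mul, M.v.map_add_eq_of_lt_left
    ((val_aeval_le_one M.v hx _).trans_lt h1)] at h2
  have h3 := val_aeval_le_one M.v hx
    (X ^ 3 + C (E⁄F).a₂ * X ^ 2 + C (E⁄F).a₄ * X + C (E⁄F).a₆)
  rw [← h2] at h3
  exact (one_lt_mul_of_lt_of_le' h1 h1.le).not_ge h3

/-- At a point of order two, `y - b` is a uniformizer: the recentred equation reads `v (v + a₁ u) =
u * unit` with `u = x - a` of order `2`. -/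
lemma v_tau_y_sub_of_eq (h : (E⁄F).Nonsingular a b)
    (hb : 2 * b + (E⁄F).a₁ * a + (E⁄F).a₃ = 0) :
    M.v (M.tau (.some a b h) M.y - algebraMap F L b) = exp (-1) := by
  have hl : 3 * a ^ 2 + 2 * (E⁄F).a₂ * a + (E⁄F).a₄ - (E⁄F).a₁ * b ≠ 0 := by
    rcases ((nonsingular_iff ..).mp h).2 with h1 | h1
    · intro h2; apply h1; linear_combination -h2
    · exact fun _ ↦ h1 (by linear_combination hb)
  have hx := M.v_tau_x_sub_of_eq h hb
  have e := M.tau_equation_sub h rfl rfl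
  rw [hb, map_zero, add_zero] at e
  set l := 3 * a ^ 2 + 2 * (E⁄F).a₂ * a + (E⁄F).a₄ - (E⁄F).a₁ * b
  set u := M.tau (.some a b h) M.x - algebraMap F L a
  set v := M.tau (.some a b h) M.y - algebraMap F L b
  have hu1 : M.v u < 1 := by rw [hx, ← exp_zero, exp_lt_exp]; norm_num
  have h0 : M.v (u ^ 2 + algebraMap F L (3 * a + (E⁄F).a₂) * u + algebraMap F L l) = 1 := by
    have := val_aeval_eq_one M.v (a := u) (c := 0) (by simpa using hu1)
      (p := X ^ 2 + C (3 * a + (E⁄F).a₂) * X + C l) (by simpa using hl)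
    simpa only [map_add, map_mul, map_pow, aeval_C, aeval_X] using this
  have h2 := congrArg M.v e
  rw [map_mul, map_mul, h0, mul_one, hx] at h2
  have h3 : M.v (algebraMap F L (E⁄F).a₁ * u) ≤ exp (-2) := by
    rw [← hx, map_mul]
    exact mul_le_of_le_one_left' (val_algebraMap_le_one M.v _)
  rcases le_or_gt (M.v v) (exp (-2)) with h4 | h4
  · have h6 := mul_le_mul' h4 (M.v.map_add_le h4 h3)
    rw [h2, ← exp_add, exp_le_exp] at h6
    omega
  · rw [M.v.map_add_eq_of_lt_left (h3.trans_lt h4), ← sq] at h2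
    exact sq_eq_exp (h2.trans (by norm_num))

/-- Its square is the cubic `4x³ + b₂x² + 2b₄x + b₆`, whose value at `a` is `(2b + a₁a + a₃)² ≠ 0`.
-/
lemma v_tau_psi (h : (E⁄F).Nonsingular a b)
    (hb : 2 * b + (E⁄F).a₁ * a + (E⁄F).a₃ ≠ 0) :
    M.v (M.tau (.some a b h) (2 * M.y + algebraMap F L (E⁄F).a₁ * M.x +
      algebraMap F L (E⁄F).a₃)) = 1 := by
  have e₁ := M.tau_equation (.some a b h)
  have e₂ := (Affine.equation_iff ..).mp h.1
  have h1 := val_aeval_eq_one M.v (M.v_tau_x_sub_lt_one h)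
    (p := C 4 * X ^ 3 + C (E⁄F).b₂ * X ^ 2 + C (2 * (E⁄F).b₄) * X + C (E⁄F).b₆) (by
      rw [b₂, b₄, b₆]
      simp only [eval_add, eval_mul, eval_pow, eval_C, eval_X]
      intro h0
      refine hb (pow_eq_zero_iff two_ne_zero |>.mp ?_)
      linear_combination h0 + 4 * e₂)
  refine (pow_eq_one_iff_of_nonneg zero_le two_ne_zero).mp ?_
  rw [← h1, ← map_pow]
  congr 1
  rw [b₂, b₄, b₆]
  simp only [map_add, map_mul, map_pow, map_ofNat, AlgHom.commutes, aeval_C, aeval_X]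
  linear_combination 4 * e₁

variable (E) in
lemma exists_nonsingular (a : F) :
    ∃ b, (E⁄F).Nonsingular a b := by
  obtain ⟨b, hb⟩ := IsAlgClosed.exists_root (X ^ 2 + C ((E⁄F).a₁ * a + (E⁄F).a₃) * X -
      C (a ^ 3 + (E⁄F).a₂ * a ^ 2 + (E⁄F).a₄ * a + (E⁄F).a₆)) (by
    have : (X ^ 2 + C ((E⁄F).a₁ * a + (E⁄F).a₃) * X -
      C (a ^ 3 + (E⁄F).a₂ * a ^ 2 + (E⁄F).a₄ * a + (E⁄F).a₆)).degree = 2 := by compute_degree!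
    rw [this]; norm_num)
  refine ⟨b, equation_iff_nonsingular.mp ((Affine.equation_iff ..).mpr ?_)⟩
  simp only [IsRoot.def, eval_sub, eval_add, eval_mul, eval_pow, eval_C, eval_X] at hb
  linear_combination hb

/-- The function `f` composed with the negation. -/
noncomputable def conj : L →ₐ[F] L := M.pull (-M.gen)

lemma neg_gen_ne_const (S : (E⁄F).Point) : -M.gen ≠ M.const S := by
  rw [Ne, neg_eq_iff_eq_neg, ← map_neg]
  exact M.gen_ne_const _

lemma map_conj_gen : Point.map M.conj M.gen = -M.gen := M.map_pull_gen M.neg_gen_ne_const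

lemma conj_x : M.conj M.x = M.x := by
  have := M.map_conj_gen
  rw [gen, Point.map_some, Point.neg_some, Point.some.injEq] at this
  exact this.1

lemma conj_y : M.conj M.y = -M.y - algebraMap F L (E⁄F).a₁ * M.x - algebraMap F L (E⁄F).a₃ := by
  have := M.map_conj_gen
  rw [gen, Point.map_some, Point.neg_some, Point.some.injEq, negY, baseChange_eq_map E F L,
    map_a₁, map_a₃] at this
  exact this.2

lemma tau_conj (S : (E⁄F).Point) (f : L) : M.tau S (M.conj f) = M.conj (M.tau (-S) f) := by
  have : (M.tau S).comp M.conj = M.conj.comp (M.tau (-S)) :=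
    M.ext_of_map_gen <| by
      rw [← Point.map_map, ← Point.map_map, map_conj_gen, map_tau_gen, map_neg, map_tau_gen,
        map_add, map_const, map_conj_gen, map_neg, neg_add]
  exact DFunLike.congr_fun this f

lemma v_conj (f : L) : M.v (M.conj f) = M.v f := by
  have := M.val_eq_pow (w := M.v.comap (M.conj : L →+* L)) one_pos (by
    change M.v (M.conj M.x) = _
    rw [conj_x, M.v_x]; rfl) f
  rw [pow_one] at this
  exact this

/-- A function is regular away from the origin. -/
def IsAffineRegular (f : L) : Prop := ∀ S : (E⁄F).Point, S ≠ 0 → M.v (M.tau S f) ≤ 1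

variable {M}

lemma IsAffineRegular.conj {f : L} (hf : M.IsAffineRegular f) : M.IsAffineRegular (M.conj f) := by
  intro S hS
  rw [tau_conj, v_conj]
  exact hf _ (neg_ne_zero.mpr hS)

/-- This is integral closedness of `F[x, y]`, one root of the denominator at a time. Away from
two-torsion, subtracting the conjugate isolates `q` times a local unit. At a point of order two,
polynomials in `x` have even order while `y - b` has order `1`, so the terms of `(p + b q) + q (y -
b)` cannot cancel. -/
lemma IsAffineRegular.dvd_of_root {f : L} (hf : M.IsAffineRegular f) {p q r : F[X]}
    (h : f * aeval M.x r = aeval M.x p + aeval M.x q * M.y) (hr : r.eval a = 0) :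
    p.eval a = 0 ∧ q.eval a = 0 := by
  obtain ⟨b, hab⟩ := exists_nonsingular E a
  have hS : Point.some a b hab ≠ 0 := Point.some_ne_zero hab
  have hlt := M.v_tau_x_sub_lt_one hab
  have hval {p : F[X]} (hp : M.v (M.tau (.some a b hab) (aeval M.x p)) < 1) : p.eval a = 0 := by
    by_contra h0
    rw [← aeval_algHom_apply] at hp
    exact hp.ne (val_aeval_eq_one M.v hlt h0)
  obtain ⟨s, hs⟩ := dvd_iff_isRoot.mpr hr
  have hfr {g : L} (hg : M.IsAffineRegular g) : M.v (M.tau (.some a b hab) (g * aeval M.x r)) ≤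
      M.v (M.tau (.some a b hab) M.x - algebraMap F L a) := by
    rw [map_mul, map_mul, ← aeval_algHom_apply, hs, map_mul, map_mul, map_sub, aeval_X, aeval_C]
    exact mul_le_of_le_one_left' (hg _ hS) |>.trans
      (mul_le_of_le_one_right' (val_aeval_le_one M.v (M.v_tau_x_le_one hab) s))
  by_cases hb : 2 * b + (E⁄F).a₁ * a + (E⁄F).a₃ = 0
  · have hx := M.v_tau_x_sub_of_eq hab hb
    have hy := M.v_tau_y_sub_of_eq hab hb
    have h1 := hfr hf
    rw [hx] at h1
    have h2 : M.tau (.some a b hab) (f * aeval M.x r) =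
        M.tau (.some a b hab) (aeval M.x (p + C b * q)) + M.tau (.some a b hab) (aeval M.x q) *
          (M.tau (.some a b hab) M.y - algebraMap F L b) := by
      rw [h]
      simp only [map_add, map_mul, aeval_C, AlgHom.commutes]
      ring
    have hqle : M.v (M.tau (.some a b hab) (aeval M.x q)) ≤ 1 := by
      rw [← aeval_algHom_apply]
      exact val_aeval_le_one M.v (M.v_tau_x_le_one hab) q
    have hple : M.v (M.tau (.some a b hab) (aeval M.x (p + C b * q))) ≤ exp (-1) := by
      rw [eq_sub_of_add_eq h2.symm]
      refine M.v.map_sub_le (h1.trans ?_) ?_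
      · rw [exp_le_exp]; norm_num
      · rw [map_mul, hy]
        exact mul_le_of_le_one_left' hqle
    have hp0 := hval (hple.trans_lt (by rw [← exp_zero, exp_lt_exp]; norm_num))
    -- A polynomial in `x` that vanishes at `a` is divisible by `x - a`, so its order jumps from at
    -- least `1` to at least `2`.
    have hple2 : M.v (M.tau (.some a b hab) (aeval M.x (p + C b * q))) ≤ exp (-2) := by
      obtain ⟨t, ht⟩ := dvd_iff_isRoot.mpr hp0
      rw [← aeval_algHom_apply, ht, map_mul, map_mul, map_sub, aeval_X, aeval_C, hx]
      exact mul_le_of_le_one_right' (val_aeval_le_one M.v (M.v_tau_x_le_one hab) t)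
    have hqlt : M.v (M.tau (.some a b hab) (aeval M.x q)) ≤ exp (-1) := by
      have : M.v (M.tau (.some a b hab) (aeval M.x q)) * exp (-1) ≤ exp (-1) * exp (-1) := by
        rw [← exp_add]
        nth_rewrite 1 [← hy]
        rw [← map_mul, ← sub_eq_of_eq_add' h2]
        exact M.v.map_sub_le h1 hple2
      exact le_of_mul_le_mul_right this exp_pos
    have hq0 := hval (hqlt.trans_lt (by rw [← exp_zero, exp_lt_exp]; norm_num))
    refine ⟨?_, hq0⟩
    rw [eval_add, eval_mul, hq0, mul_zero, add_zero] at hp0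
    exact hp0
  · have h1 := (hfr hf).trans_lt hlt
    have h2 := (hfr hf.conj).trans_lt hlt
    have h3 : M.conj f * aeval M.x r = aeval M.x p + aeval M.x q * M.conj M.y := by
      have := congrArg M.conj h
      simpa only [map_mul, map_add, ← aeval_algHom_apply, conj_x] using this
    have h4 : f * aeval M.x r - M.conj f * aeval M.x r = aeval M.x q * (2 * M.y +
        algebraMap F L (E⁄F).a₁ * M.x + algebraMap F L (E⁄F).a₃) := by
      rw [h, h3, conj_y]; ring
    have h5 := M.v.map_sub_lt h1 h2
    rw [← map_sub, h4, map_mul, map_mul, M.v_tau_psi hab hb, mul_one] at h5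
    have hq0 := hval h5
    refine ⟨hval ?_, hq0⟩
    rw [eq_sub_of_add_eq h.symm, map_sub]
    refine M.v.map_sub_lt h1 ?_
    rw [map_mul, map_mul]
    exact mul_lt_one_of_nonneg_of_lt_one_left zero_le h5 (M.v_tau_y_le_one hab)

lemma IsAffineRegular.exists_poly {f : L} (hf : M.IsAffineRegular f) :
    ∃ p q : F[X], f = aeval M.x p + aeval M.x q * M.y := by
  obtain ⟨p, q, r, hr, h⟩ := M.exists_rep f
  induction hn : r.natDegree generalizing p q r with
  | zero =>
    obtain ⟨c, rfl⟩ := natDegree_eq_zero.mp hn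
    have hc : c ≠ 0 := by rintro rfl; simp at hr
    have hc' : algebraMap F L c ≠ 0 := by simpa using hc
    refine ⟨C c⁻¹ * p, C c⁻¹ * q, ?_⟩
    rw [aeval_C] at h
    simp only [map_mul, aeval_C, map_inv₀]
    field_simp
    exact h
  | succ n ih =>
    obtain ⟨z, hz⟩ := IsAlgClosed.exists_root r (by
      rw [degree_eq_natDegree hr, hn]; exact_mod_cast Nat.succ_ne_zero n)
    obtain ⟨hp, hq⟩ := hf.dvd_of_root h hz
    obtain ⟨p, rfl⟩ := dvd_iff_isRoot.mpr hp
    obtain ⟨q, rfl⟩ := dvd_iff_isRoot.mpr hq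
    obtain ⟨r, rfl⟩ := dvd_iff_isRoot.mpr hz
    have hr0 : r ≠ 0 := right_ne_zero_of_mul hr
    refine ih p q r hr0 ?_ ?_
    · refine mul_left_cancel₀ (M.aeval_x_eq_zero.not.mpr (X_sub_C_ne_zero z)) ?_
      simp only [map_mul] at h
      linear_combination h
    · rw [natDegree_mul (X_sub_C_ne_zero z) hr0, natDegree_X_sub_C] at hn
      omega

/-- Pole orders at infinity of polynomials in `x, y` are `0, 2, 3, …`, never `1`. This stands in for
Riemann–Roch and expresses that the genus is not zero. -/
lemma IsAffineRegular.exists_const {f : L} (hf : M.IsAffineRegular f) (h : M.v f ≤ exp 1) :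
    ∃ c, f = algebraMap F L c := by
  obtain ⟨p, q, rfl⟩ := hf.exists_poly
  rw [M.v_aeval_add, max_le_iff] at h
  have hq : q = 0 := by
    by_contra hq
    have := h.2
    rw [map_mul, M.v_aeval hq, M.v_y, ← exp_add, exp_le_exp] at this
    omega
  subst hq
  by_cases hp : p = 0
  · exact ⟨0, by simp [hp]⟩
  have := h.1
  rw [M.v_aeval hp, exp_le_exp] at this
  obtain ⟨c, rfl⟩ := natDegree_eq_zero.mp (show p.natDegree = 0 by omega)
  exact ⟨c, by simp⟩

end regular
end FunctionFieldModel

/-! ### Principal divisors, divisor classes of points, and divisibility. -/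

namespace FunctionFieldModel

open WeierstrassCurve WeierstrassCurve.Affine

section divisors

variable {K : Type u} [Field K] {E : WeierstrassCurve K} {F : Type v} {L : Type w} [Field F]
  [Field L] [Algebra K F] [Algebra F L] [Algebra K L] [IsScalarTower K F L]
  (M : FunctionFieldModel E F L) [E.IsElliptic] [DecidableEq F] [DecidableEq L] [IsAlgClosed F]

lemma v_tau_le_one_iff {f : L} (hf : f ≠ 0) (S : (E⁄F).Point) :
    M.v (M.tau S f) ≤ 1 ↔ 0 ≤ M.div f S := by
  rw [M.v_tau hf, ← exp_zero, exp_le_exp, neg_nonpos]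

lemma exists_const_of_div {f : L} (hf : f ≠ 0) (h : ∀ S, S ≠ 0 → 0 ≤ M.div f S)
    (h0 : -1 ≤ M.div f 0) : ∃ c : F, c ≠ 0 ∧ f = algebraMap F L c := by
  have h1 : M.IsAffineRegular f := fun S hS ↦ (M.v_tau_le_one_iff hf S).mpr (h S hS)
  obtain ⟨c, rfl⟩ := h1.exists_const (by
    have := M.v_tau hf 0
    rw [tau_zero, AlgHom.id_apply] at this
    rw [this, exp_le_exp]; omega)
  exact ⟨c, by rintro rfl; simp at hf, rfl⟩

lemma exists_const_of_div_eq {f g : L} (hf : f ≠ 0) (hg : g ≠ 0) (h : M.div f = M.div g) :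
    ∃ c : F, c ≠ 0 ∧ f = algebraMap F L c * g := by
  have h1 : M.div (f * g⁻¹) = 0 := by
    rw [M.div_mul hf (inv_ne_zero hg), div_inv, h, add_neg_cancel]
  obtain ⟨c, hc, h2⟩ := M.exists_const_of_div (mul_ne_zero hf (inv_ne_zero hg))
    (fun S _ ↦ by rw [h1]; rfl) (by rw [h1]; exact neg_one_lt_zero.le)
  exact ⟨c, hc, by rw [← h2, inv_mul_cancel_right₀ hg]⟩

/-- The group of principal divisors. -/
noncomputable def principal : AddSubgroup ((E⁄F).Point → ℤ) where
  carrier := {d | ∃ f : L, f ≠ 0 ∧ M.div f = d}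
  zero_mem' := ⟨1, one_ne_zero, by rw [← map_one (algebraMap F L), div_const]⟩
  add_mem' := by
    rintro _ _ ⟨f, hf, rfl⟩ ⟨g, hg, rfl⟩
    exact ⟨f * g, mul_ne_zero hf hg, M.div_mul hf hg⟩
  neg_mem' := by
    rintro _ ⟨f, hf, rfl⟩
    exact ⟨f⁻¹, inv_ne_zero hf, M.div_inv f⟩

open Classical in
/-- The divisor of a point. -/
noncomputable def pointDiv (P S : (E⁄F).Point) : ℤ := if S = P then 1 else 0

lemma pointDiv_self (P : (E⁄F).Point) : pointDiv P P = 1 := if_pos rfl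

lemma pointDiv_of_ne {P S : (E⁄F).Point} (h : S ≠ P) : pointDiv P S = 0 := if_neg h

lemma pointDiv_add (P A S : (E⁄F).Point) : pointDiv (P + A) (S + A) = pointDiv P S := by
  simp [pointDiv]

lemma principal_translate {d : (E⁄F).Point → ℤ} (hd : d ∈ M.principal) (A : (E⁄F).Point) :
    (fun S ↦ d (S + A)) ∈ M.principal := by
  obtain ⟨f, hf, rfl⟩ := hd
  exact ⟨M.tau A f, by simpa using hf, funext fun S ↦ M.div_tau f S A⟩

lemma div_x_sub {a b : F} (h : (E⁄F).Nonsingular a b) : M.div (M.x - algebraMap F L a) =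
    pointDiv (.some a b h) + pointDiv (-.some a b h) - 2 • pointDiv 0 := by
  have hne : M.x - algebraMap F L a ≠ 0 := sub_ne_zero.mpr (M.x_ne_const a)
  have hP : Point.some a b h ≠ 0 := Point.some_ne_zero h
  ext S
  rw [Pi.sub_apply, Pi.add_apply, Pi.smul_apply, M.div_eq_iff hne, map_sub, AlgHom.commutes]
  cases S with
  | zero =>
    rw [← Point.zero_def, pointDiv_self, pointDiv_of_ne hP.symm,
      pointDiv_of_ne (neg_ne_zero.mpr hP).symm, tau_zero, AlgHom.id_apply, v_x_sub]
    rfl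
  | some a' b' h' =>
    rw [pointDiv_of_ne (Point.some_ne_zero h'), smul_zero, sub_zero]
    by_cases ha : a' = a
    · subst ha
      by_cases hb : 2 * b' + (E⁄F).a₁ * a' + (E⁄F).a₃ = 0
      · have h1 : b = b' := by
          rcases Y_eq_of_X_eq h.1 h'.1 rfl with h1 | h1
          · exact h1
          · rw [negY] at h1; rw [h1]; linear_combination -hb
        subst h1
        have h2 : -Point.some a' b h = Point.some a' b h := by
          rw [Point.neg_some, Point.some.injEq, negY]
          exact ⟨rfl, by linear_combination -hb⟩
        rw [h2, pointDiv_self, M.v_tau_x_sub_of_eq h' hb]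
        rfl
      · have h2 : -Point.some a' b' h' ≠ Point.some a' b' h' := by
          rw [Point.neg_some, Ne, Point.some.injEq, negY]
          exact fun h3 ↦ hb (by linear_combination -h3.2)
        rw [M.v_tau_x_sub_of_ne h' hb]
        rcases Y_eq_of_X_eq h'.1 h.1 rfl with h1 | h1
        · subst h1
          rw [pointDiv_self, pointDiv_of_ne h2.symm]; rfl
        · have h3 : Point.some a' b' h' = -Point.some a' b h := by
            rw [Point.neg_some, Point.some.injEq]; exact ⟨rfl, h1⟩
          rw [← h3, pointDiv_self, pointDiv_of_ne]
          · rfl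
          · intro h4; rw [← h4] at h3; exact h2 h3.symm
    · rw [pointDiv_of_ne, pointDiv_of_ne, val_sub_eq_one M.v (M.v_tau_x_sub_lt_one h') ha]
      · rfl
      · rw [Point.neg_some, Ne, Point.some.injEq]; exact fun h ↦ ha h.1
      · rw [Ne, Point.some.injEq]; exact fun h ↦ ha h.1

/-- It is the divisor of `x - x(P)`, cut out by a vertical line, translated by `A`. No other chord
is needed for additivity of `cls`. -/
lemma pointDiv_add_add_sub_mem (A P : (E⁄F).Point) :
    pointDiv (A + P) + pointDiv (A - P) - 2 • pointDiv A ∈ M.principal := by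
  cases P with
  | zero =>
    rw [← Point.zero_def, add_zero, sub_zero, two_nsmul, sub_self]
    exact zero_mem _
  | some a b h =>
    have h1 := M.principal_translate (d := M.div (M.x - algebraMap F L a))
      ⟨_, sub_ne_zero.mpr (M.x_ne_const a), rfl⟩ (-A)
    convert! h1 using 1
    ext S
    rw [M.div_x_sub h]
    simp only [Pi.sub_apply, Pi.add_apply, Pi.smul_apply]
    have e (P : (E⁄F).Point) : pointDiv P (S + -A) = pointDiv (A + P) S := by
      rw [← pointDiv_add P A, neg_add_cancel_right, add_comm]
    rw [e, e, e, ← sub_eq_add_neg, add_zero]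

/-- The class of the divisor `(P) - (O)`. -/
noncomputable def cls (P : (E⁄F).Point) : ((E⁄F).Point → ℤ) ⧸ M.principal :=
  QuotientAddGroup.mk (pointDiv P - pointDiv 0)

lemma cls_zero : M.cls 0 = 0 := by rw [cls, sub_self]; rfl

lemma cls_add_add_cls_sub (A P : (E⁄F).Point) : M.cls (A + P) + M.cls (A - P) = 2 • M.cls A := by
  rw [cls, cls, cls, ← QuotientAddGroup.mk_add, ← QuotientAddGroup.mk_nsmul,
    QuotientAddGroup.eq_iff_sub_mem]
  convert! M.pointDiv_add_add_sub_mem A P using 1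
  simp only [two_nsmul]
  abel

include M in
-- For `x ∘ [n] = p / q`, the polynomial `p - a q` has degree `n ^ 2 > 0`. Above a root of it lies a
-- point `S` with `x(n • S) = a`, so `n • S` is the target up to sign.
lemma exists_nsmul_eq {n : ℕ} (hn : 0 < n) (T : (E⁄F).Point) : ∃ S, n • S = T := by
  cases T with
  | zero => exact ⟨0, nsmul_zero n⟩
  | some a b h =>
    obtain ⟨p, q, hp, hpd, hqd, -, hpq, hq, hx⟩ := M.exists_mulPull_x hn
    have hdeg : (p - C a * q).natDegree = n ^ 2 := by
      rw [← hpd]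
      refine natDegree_sub_eq_left_of_natDegree_lt ?_
      rw [hpd]
      exact (natDegree_C_mul_le _ _).trans_lt hqd
    obtain ⟨x₀, hx₀⟩ := IsAlgClosed.exists_root (p - C a * q) (by
      intro h0
      rw [natDegree_eq_zero_iff_degree_le_zero.mpr h0.le] at hdeg
      exact (pow_pos hn 2).ne hdeg)
    rw [IsRoot.def, eval_sub, eval_mul, eval_C] at hx₀
    have hq₀ : q.eval x₀ ≠ 0 := by
      intro hq₀
      obtain ⟨r, s, hrs⟩ := hpq
      have := congrArg (eval x₀) hrs
      rw [hq₀, mul_zero, sub_zero] at hx₀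
      simp [hx₀, hq₀] at this
    obtain ⟨y₀, h₀⟩ := exists_nonsingular E x₀
    set S := Point.some x₀ y₀ h₀
    obtain ⟨e, he, -, hv⟩ := M.exists_v_mulPull hn
    have hlt := M.v_tau_x_sub_lt_one h₀
    have h1 : M.v (M.tau (n • S) M.x - algebraMap F L a) < 1 := by
      have h2 := congrArg (M.tau S) hx
      rw [map_mul, ← aeval_algHom_apply, ← aeval_algHom_apply, M.tau_mulPull hn] at h2
      have h3 : M.mulPull n (M.tau (n • S) M.x - algebraMap F L a) * aeval (M.tau S M.x) q =
          aeval (M.tau S M.x) (p - C a * q) := by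
        rw [map_sub, AlgHom.commutes, sub_mul, h2, map_sub, map_mul, aeval_C]
      have h4 := congrArg M.v h3
      rw [map_mul, val_aeval_eq_one M.v hlt hq₀, mul_one, hv] at h4
      have h5 := val_aeval_sub_lt_one M.v hlt (p - C a * q)
      rw [eval_sub, eval_mul, eval_C, hx₀, map_zero, sub_zero, ← h4] at h5
      exact (pow_lt_one_iff_of_nonneg zero_le he.ne').mp h5
    have h2 : n • S = .some a b h ∨ n • S = -.some a b h := by
      cases hS : n • S with
      | zero =>
        rw [hS, ← Point.zero_def, tau_zero, AlgHom.id_apply, v_x_sub, ← exp_zero, exp_lt_exp] at h1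
        omega
      | some a' b' h' =>
        rw [hS] at h1
        have := eq_of_sub_lt_one M.v (M.v_tau_x_sub_lt_one h') h1
        subst this
        rcases Y_eq_of_X_eq h'.1 h.1 rfl with h6 | h6
        · left; subst h6; rfl
        · right; rw [Point.neg_some, Point.some.injEq]; exact ⟨rfl, h6⟩
    rcases h2 with h2 | h2
    · exact ⟨S, h2⟩
    · exact ⟨-S, by rw [smul_neg, h2, neg_neg]⟩

lemma cls_two_nsmul (A : (E⁄F).Point) : M.cls (2 • A) = 2 • M.cls A := by
  rw [← M.cls_add_add_cls_sub A A, sub_self, cls_zero, add_zero, two_nsmul]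

lemma cls_neg (A : (E⁄F).Point) : M.cls (-A) = -M.cls A := by
  have := M.cls_add_add_cls_sub 0 A
  rw [cls_zero, smul_zero, zero_add, zero_sub] at this
  exact eq_neg_of_add_eq_zero_right this

/-- The parallelogram law for `(A, B)` and `(B, A)` gives only twice the claim, and the class group
might have two-torsion. Halving the points first absorbs the factor, since `cls (2 • A) = 2 • cls
A`. -/
lemma cls_add (A B : (E⁄F).Point) : M.cls (A + B) = M.cls A + M.cls B := by
  obtain ⟨A, rfl⟩ := M.exists_nsmul_eq two_pos A
  obtain ⟨B, rfl⟩ := M.exists_nsmul_eq two_pos B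
  have h1 := M.cls_add_add_cls_sub A B
  have h2 := M.cls_add_add_cls_sub B A
  rw [← neg_sub A B, cls_neg, add_comm B A] at h2
  rw [← nsmul_add, cls_two_nsmul, cls_two_nsmul, cls_two_nsmul, ← h1, ← h2, two_nsmul]
  abel

/-- The class of `(P) - (O)`, as a homomorphism. -/
noncomputable def clsHom : (E⁄F).Point →+ ((E⁄F).Point → ℤ) ⧸ M.principal where
  toFun := M.cls
  map_zero' := M.cls_zero
  map_add' := M.cls_add

/-- A function with divisor `(P) - (O)` has at most a simple pole at the origin, hence is constant.
-/
lemma eq_zero_of_cls_eq_zero {P : (E⁄F).Point} (h : M.cls P = 0) : P = 0 := by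
  by_contra hP
  obtain ⟨f, hf, hd⟩ := (QuotientAddGroup.eq_zero_iff _).mp h
  obtain ⟨c, hc, rfl⟩ := M.exists_const_of_div hf
    (fun S hS ↦ by
      rw [hd, Pi.sub_apply, pointDiv_of_ne hS, sub_zero, pointDiv]
      split_ifs <;> norm_num)
    (by rw [hd, Pi.sub_apply, pointDiv_self, pointDiv_of_ne (Ne.symm hP)]; norm_num)
  rw [div_const] at hd
  have := congrFun hd P
  rw [Pi.sub_apply, pointDiv_self, pointDiv_of_ne hP] at this
  norm_num at this

end divisors
end FunctionFieldModel

/-! ### Counting the `n`-torsion. -/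

namespace FunctionFieldModel

open WeierstrassCurve WeierstrassCurve.Affine

section torsion

variable {K : Type u} [Field K] {E : WeierstrassCurve K} {F : Type v} {L : Type w} [Field F]
  [Field L] [Algebra K F] [Algebra F L] [Algebra K L] [IsScalarTower K F L]
  (M : FunctionFieldModel E F L) [E.IsElliptic] [DecidableEq F] [DecidableEq L] [IsAlgClosed F]

lemma v_aeval_tau_x {a b : F} (h : (E⁄F).Nonsingular a b) {p : F[X]} (hp : p ≠ 0) :
    M.v (aeval (M.tau (.some a b h) M.x) p) =
      M.v (M.tau (.some a b h) M.x - algebraMap F L a) ^ p.rootMultiplicity a := by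
  obtain ⟨q, hq, hq'⟩ := exists_eq_pow_rootMultiplicity_mul_and_not_dvd p hp a
  have h1 := val_aeval_eq_one M.v (M.v_tau_x_sub_lt_one h) (fun h0 ↦ hq' (dvd_iff_isRoot.mpr h0))
  conv_lhs => rw [hq, map_mul, map_mul, h1, mul_one, map_pow, map_pow, map_sub, aeval_X, aeval_C]

include M in
-- `q` is the denominator of `x ∘ [n]`. As `[n]` is unramified, `x ∘ [n]` has a double pole at each
-- torsion point `S`, so `q(x)` vanishes there to order `2`, while `x - a` has order `2` or `1`
-- according as `2 • S = 0` or not.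
lemma exists_torsion_poly {n : ℕ} (hn : (n : F) ≠ 0) : ∃ q : F[X], q ≠ 0 ∧ q.natDegree + 1 = n ^ 2 ∧
    ∀ (a b : F) (h : (E⁄F).Nonsingular a b), (n • Point.some a b h = 0 ↔ q.eval a = 0) ∧
      (q.eval a = 0 → q.rootMultiplicity a =
        if 2 * b + (E⁄F).a₁ * a + (E⁄F).a₃ = 0 then 1 else 2) := by
  have h0 : 0 < n := Nat.pos_of_ne_zero (by rintro rfl; simp at hn)
  obtain ⟨p, q, hp, hpd, hqd, hqd', hpq, hq, hx⟩ := M.exists_mulPull_x h0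
  refine ⟨q, hq, hqd' hn, fun a b h ↦ ?_⟩
  set S := Point.some a b h
  have hlt := M.v_tau_x_sub_lt_one h
  have h1 := congrArg (fun f ↦ M.v (M.tau S f)) hx
  simp only [map_mul, ← aeval_algHom_apply] at h1
  rw [M.tau_mulPull h0, M.v_mulPull hn] at h1
  have hp1 : q.eval a = 0 → M.v (aeval (M.tau S M.x) p) = 1 := by
    refine fun hq0 ↦ val_aeval_eq_one M.v hlt fun hp0 ↦ ?_
    obtain ⟨r, s, hrs⟩ := hpq
    have := congrArg (eval a) hrs
    simp [hp0, hq0] at this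
  have hiff : n • S = 0 ↔ q.eval a = 0 := by
    refine ⟨fun hS ↦ ?_, fun hq0 ↦ ?_⟩
    · by_contra hq0
      rw [val_aeval_eq_one M.v hlt hq0, hS, tau_zero, AlgHom.id_apply, mul_one, M.v_x] at h1
      have h2 := val_aeval_le_one M.v (M.v_tau_x_le_one h) p
      rw [← h1, ← exp_zero, exp_le_exp] at h2
      omega
    · cases hS : n • S with
      | zero => rfl
      | some a' b' h' =>
        exfalso
        have h2 := M.v_tau_x_le_one h'
        rw [← hS] at h2
        have h3 := val_aeval_sub_lt_one M.v hlt q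
        rw [hq0, map_zero, sub_zero] at h3
        rw [hp1 hq0] at h1
        exact h1.not_lt (mul_lt_one_of_nonneg_of_lt_one_right h2 zero_le h3)
  refine ⟨hiff, fun hq0 ↦ ?_⟩
  rw [hp1 hq0, hiff.mpr hq0, tau_zero, AlgHom.id_apply, M.v_x, M.v_aeval_tau_x h hq] at h1
  split_ifs with hb
  · rw [M.v_tau_x_sub_of_eq h hb, ← exp_nsmul, ← exp_add, exp_eq_one] at h1
    rw [nsmul_eq_mul] at h1
    omega
  · rw [M.v_tau_x_sub_of_ne h hb, ← exp_nsmul, ← exp_add, exp_eq_one] at h1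
    rw [nsmul_eq_mul] at h1
    omega

variable (E) in
/-- The points with a given `x`-coordinate. -/
noncomputable def fiber (a : F) : Finset (E⁄F).Point :=
  {.some a _ (exists_nonsingular E a).choose_spec, -.some a _ (exists_nonsingular E a).choose_spec}

lemma mem_fiber {a : F} {S : (E⁄F).Point} : S ∈ fiber E a ↔ ∃ b h, S = .some a b h := by
  rw [fiber, Finset.mem_insert, Finset.mem_singleton]
  set h₀ := (exists_nonsingular E a).choose_spec
  constructor
  · rintro (rfl | rfl)
    · exact ⟨_, _, rfl⟩
    · exact ⟨_, _, Point.neg_some h₀⟩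
  · rintro ⟨b, h, rfl⟩
    rw [Point.neg_some, Point.some.injEq, Point.some.injEq]
    rcases Y_eq_of_X_eq h.1 h₀.1 rfl with h1 | h1
    · exact .inl ⟨rfl, h1⟩
    · exact .inr ⟨rfl, h1⟩

lemma card_fiber {a b : F} (h : (E⁄F).Nonsingular a b) : (fiber E a).card =
    if 2 * b + (E⁄F).a₁ * a + (E⁄F).a₃ = 0 then 1 else 2 := by
  have h1 : fiber E a = {.some a b h, -.some a b h} := by
    have h0 := (exists_nonsingular E a).choose_spec
    have : (.some a b h : (E⁄F).Point) ∈ fiber E a := mem_fiber.mpr ⟨b, h, rfl⟩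
    rw [fiber, Finset.mem_insert, Finset.mem_singleton] at this
    rcases this with h2 | h2
    · rw [fiber, ← h2]
    · rw [fiber, h2, neg_neg, Finset.pair_comm]
  rw [h1]
  split_ifs with hb
  · have h2 : -Point.some a b h = Point.some a b h := by
      rw [Point.neg_some, Point.some.injEq, negY]
      exact ⟨rfl, by linear_combination -hb⟩
    rw [h2, Finset.pair_eq_singleton, Finset.card_singleton]
  · refine Finset.card_pair ?_
    rw [Point.neg_some, Ne, Point.some.injEq, negY]
    exact fun h3 ↦ hb (by linear_combination h3.2)

include M in
-- The multiplicity of each root of `q` equals the number of points above it, so there are `deg q =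
-- n ^ 2 - 1` affine torsion points; the origin is the last one.
lemma exists_torsion_finset {n : ℕ} (hn : (n : F) ≠ 0) :
    ∃ s : Finset (E⁄F).Point, (∀ S, S ∈ s ↔ n • S = 0) ∧ s.card = n ^ 2 := by
  obtain ⟨q, hq, hqd, h⟩ := M.exists_torsion_poly hn
  refine ⟨insert 0 (q.roots.toFinset.biUnion (fiber E)), fun S ↦ ?_, ?_⟩
  · rw [Finset.mem_insert, Finset.mem_biUnion]
    simp only [Multiset.mem_toFinset, mem_roots hq, IsRoot.def, mem_fiber]
    cases S with
    | zero => simp [← Point.zero_def]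
    | some a b hab =>
      rw [(h a b hab).1]
      constructor
      · rintro (h1 | ⟨a', h1, b', h2, h3⟩)
        · exact absurd h1 (Point.some_ne_zero hab)
        · rw [Point.some.injEq] at h3
          rwa [h3.1]
      · exact fun h1 ↦ .inr ⟨a, h1, b, hab, rfl⟩
  · rw [Finset.card_insert_of_notMem, Finset.card_biUnion, ← hqd, add_left_inj,
      ← IsAlgClosed.card_roots_eq_natDegree, ← Multiset.toFinset_sum_count_eq]
    · refine Finset.sum_congr rfl fun a ha ↦ ?_
      rw [Multiset.mem_toFinset, mem_roots hq] at ha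
      obtain ⟨b, hab⟩ := exists_nonsingular E a
      rw [card_fiber hab, count_roots, (h a b hab).2 ha]
    · intro a _ a' _ haa'
      rw [Function.onFun, Finset.disjoint_left]
      intro S h1 h2
      obtain ⟨b, h1, rfl⟩ := mem_fiber.mp h1
      obtain ⟨b', h2, h3⟩ := mem_fiber.mp h2
      rw [Point.some.injEq] at h3
      exact haa' h3.1
    · rw [Finset.mem_biUnion]
      rintro ⟨a, -, h1⟩
      obtain ⟨b, hb, h1⟩ := mem_fiber.mp h1
      exact Point.some_ne_zero hb h1.symm

end torsion
end FunctionFieldModel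

/-! ### Descent of torsion-invariant functions along `[n]`. -/

namespace FunctionFieldModel

open WeierstrassCurve WeierstrassCurve.Affine

section descent

variable {K : Type u} [Field K] {E : WeierstrassCurve K} {F : Type v} {L : Type w} [Field F]
  [Field L] [Algebra K F] [Algebra F L] [Algebra K L] [IsScalarTower K F L]
  (M : FunctionFieldModel E F L) [E.IsElliptic] [DecidableEq F] [DecidableEq L] [IsAlgClosed F]
  {n : ℕ}

/-- Invariance under translation by `n`-torsion points and regularity away from them. -/
def IsTorsionInvariant (n : ℕ) (G : L) : Prop :=
  (∀ S : (E⁄F).Point, n • S = 0 → M.tau S G = G) ∧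
    ∀ S : (E⁄F).Point, n • S ≠ 0 → M.v (M.tau S G) ≤ 1

variable {M}

namespace IsTorsionInvariant

lemma add {G H : L} (hG : M.IsTorsionInvariant n G) (hH : M.IsTorsionInvariant n H) :
    M.IsTorsionInvariant n (G + H) :=
  ⟨fun S hS ↦ by rw [map_add, hG.1 S hS, hH.1 S hS],
    fun S hS ↦ by rw [map_add]; exact M.v.map_add_le (hG.2 S hS) (hH.2 S hS)⟩

lemma mul {G H : L} (hG : M.IsTorsionInvariant n G) (hH : M.IsTorsionInvariant n H) :
    M.IsTorsionInvariant n (G * H) :=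
  ⟨fun S hS ↦ by rw [map_mul, hG.1 S hS, hH.1 S hS],
    fun S hS ↦ by rw [map_mul, map_mul]; exact mul_le_one' (hG.2 S hS) (hH.2 S hS)⟩

lemma const (c : F) : M.IsTorsionInvariant n (algebraMap F L c) :=
  ⟨fun S _ ↦ AlgHom.commutes _ _, fun S _ ↦ by
    rw [AlgHom.commutes]; exact val_algebraMap_le_one M.v c⟩

lemma sub_const_mul {G H : L} (hG : M.IsTorsionInvariant n G) (hH : M.IsTorsionInvariant n H)
    (c : F) : M.IsTorsionInvariant n (G - algebraMap F L c * H) := by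
  have := hG.add ((const (-c)).mul hH)
  rwa [map_neg, neg_mul, ← sub_eq_add_neg] at this

lemma mulPull (hn : (n : F) ≠ 0) {u : L} (hu : M.IsAffineRegular u) :
    M.IsTorsionInvariant n (M.mulPull n u) := by
  have h0 : 0 < n := Nat.pos_of_ne_zero (by rintro rfl; simp at hn)
  refine ⟨fun S hS ↦ ?_, fun S hS ↦ ?_⟩
  · rw [M.tau_mulPull h0, hS, tau_zero, AlgHom.id_apply]
  · rw [M.tau_mulPull h0, M.v_mulPull hn]
    exact hu _ hS

lemma exists_const {G : L} (hG : M.IsTorsionInvariant n G) (h : M.v G ≤ 1) :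
    ∃ c : F, G = algebraMap F L c := by
  have h1 : M.IsAffineRegular G := fun S _ ↦ by
    by_cases hS : n • S = 0
    · rwa [hG.1 S hS]
    · exact hG.2 S hS
  exact h1.exists_const (h.trans (by rw [← exp_zero, exp_le_exp]; norm_num))

end IsTorsionInvariant

variable (M) in
lemma isAffineRegular_x : M.IsAffineRegular M.x := by
  intro S hS
  cases S with
  | zero => exact absurd rfl hS
  | some a b h => exact M.v_tau_x_le_one h

variable (M) in
lemma isAffineRegular_y : M.IsAffineRegular M.y := by
  intro S hS
  cases S with
  | zero => exact absurd rfl hS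
  | some a b h => exact M.v_tau_y_le_one h

lemma IsAffineRegular.mul {f g : L} (hf : M.IsAffineRegular f) (hg : M.IsAffineRegular g) :
    M.IsAffineRegular (f * g) := fun S hS ↦ by
  rw [map_mul, map_mul]; exact mul_le_one' (hf S hS) (hg S hS)

lemma IsAffineRegular.pow {f : L} (hf : M.IsAffineRegular f) (k : ℕ) :
    M.IsAffineRegular (f ^ k) := fun S hS ↦ by
  rw [map_pow, map_pow]; exact pow_le_one' (hf S hS) k

variable (M) in
lemma exists_isAffineRegular_v {k : ℕ} (hk : 2 ≤ k) : ∃ f, M.IsAffineRegular f ∧ M.v f = exp (k : ℤ) := by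
  rcases Nat.even_or_odd' k with ⟨m, rfl | rfl⟩
  · refine ⟨M.x ^ m, M.isAffineRegular_x.pow m, ?_⟩
    rw [map_pow, M.v_x, ← exp_nsmul]
    congr 1
    push_cast [nsmul_eq_mul]; ring
  · refine ⟨M.x ^ (m - 1) * M.y, (M.isAffineRegular_x.pow _).mul M.isAffineRegular_y, ?_⟩
    rw [map_mul, map_pow, M.v_x, M.v_y, ← exp_nsmul, ← exp_add]
    congr 1
    rw [nsmul_eq_mul]
    omega

lemma exists_sub_const_mul_lt {G H : L} (h : M.v G = M.v H) (hH : H ≠ 0) :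
    ∃ c : F, M.v (G - algebraMap F L c * H) < M.v H := by
  have hv : M.v H ≠ 0 := M.v.ne_zero_iff.mpr hH
  obtain ⟨c, hc⟩ := M.exists_residue (f := G / H) (by rw [map_div₀, h, div_self hv])
  refine ⟨c, ?_⟩
  have : G - algebraMap F L c * H = (G / H - algebraMap F L c) * H := by field_simp
  rw [this, map_mul]
  exact mul_lt_of_lt_one_left (zero_lt_iff.mpr hv) hc

lemma lt_exp_iff {a : ℤᵐ⁰} {k : ℤ} : a < exp k ↔ a ≤ exp (k - 1) := by
  by_cases ha : a = 0
  · simp [ha]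
  · rw [← exp_log ha, exp_lt_exp, exp_le_exp]; omega

lemma v_eq_zero_or (f : L) : f = 0 ∨ ∃ k : ℤ, M.v f = exp k := by
  by_cases hf : f = 0
  · exact .inl hf
  · exact .inr ⟨log (M.v f), (exp_log (M.v.ne_zero_iff.mpr hf)).symm⟩

namespace IsTorsionInvariant

lemma exists_eq_of_le {G H : L} (hG : M.IsTorsionInvariant n G) (hH : M.IsTorsionInvariant n H)
    (hHv : M.v H = exp 1) (h : M.v G ≤ exp 1) :
    ∃ c d : F, G = algebraMap F L c * H + algebraMap F L d := by
  have hH0 : H ≠ 0 := by rintro rfl; rw [map_zero] at hHv; exact exp_ne_zero hHv.symm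
  rcases h.lt_or_eq with h1 | h1
  · rw [lt_exp_iff, sub_self, exp_zero] at h1
    obtain ⟨d, hd⟩ := hG.exists_const h1
    exact ⟨0, d, by simp [hd]⟩
  · obtain ⟨c, hc⟩ := exists_sub_const_mul_lt (h1.trans hHv.symm) hH0
    rw [hHv, lt_exp_iff, sub_self, exp_zero] at hc
    obtain ⟨d, hd⟩ := (hG.sub_const_mul hH c).exists_const hc
    exact ⟨c, d, by rw [← hd]; ring⟩

/-- Order `1` is not the pole order of a pullback of a regular function, so leading terms cannot be
subtracted. Instead, with `X, Y` the pullbacks of `x, y`, comparing poles gives `G² = αX + cG + d`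
and `G³ = γY + δX + εG + ζ`; eliminating the powers leaves a linear equation for `G` over the field
of pullbacks. -/
lemma exists_mulPull_of_v_eq (hn : (n : F) ≠ 0) {G : L} (hG : M.IsTorsionInvariant n G)
    (h : M.v G = exp 1) : ∃ u, G = M.mulPull n u := by
  have hX := mulPull hn M.isAffineRegular_x
  have hY := mulPull hn M.isAffineRegular_y
  have vX : M.v (M.mulPull n M.x) = exp 2 := by rw [M.v_mulPull hn, M.v_x]
  have vY : M.v (M.mulPull n M.y) = exp 3 := by rw [M.v_mulPull hn, M.v_y]
  have hX0 : M.mulPull n M.x ≠ 0 := by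
    intro h0; rw [h0, map_zero] at vX; exact exp_ne_zero vX.symm
  have hY0 : M.mulPull n M.y ≠ 0 := by
    intro h0; rw [h0, map_zero] at vY; exact exp_ne_zero vY.symm
  have v2 : M.v (G * G) = exp 2 := by rw [map_mul, h, ← exp_add]; rfl
  have v3 : M.v (G * G * G) = exp 3 := by rw [map_mul, v2, h, ← exp_add]; rfl
  obtain ⟨α, hα⟩ := exists_sub_const_mul_lt (v2.trans vX.symm) hX0
  have hα0 : α ≠ 0 := by
    rintro rfl
    rw [map_zero, zero_mul, sub_zero, v2, vX] at hα
    exact hα.false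
  rw [vX, lt_exp_iff] at hα
  obtain ⟨c, d, hcd⟩ := ((hG.mul hG).sub_const_mul hX α).exists_eq_of_le hG h hα
  obtain ⟨γ, hγ⟩ := exists_sub_const_mul_lt (v3.trans vY.symm) hY0
  rw [vY, lt_exp_iff] at hγ
  have hG3 := ((hG.mul hG).mul hG).sub_const_mul hY γ
  obtain ⟨δ, hδ⟩ : ∃ δ : F, M.v (G * G * G - algebraMap F L γ * M.mulPull n M.y -
      algebraMap F L δ * M.mulPull n M.x) ≤ exp 1 := by
    rcases hγ.lt_or_eq with h1 | h1
    · exact ⟨0, by rw [map_zero, zero_mul, sub_zero]; exact lt_exp_iff.mp h1⟩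
    · obtain ⟨δ, hδ⟩ := exists_sub_const_mul_lt (h1.trans vX.symm) hX0
      rw [vX, lt_exp_iff] at hδ
      exact ⟨δ, hδ⟩
  obtain ⟨ε, ζ, hεζ⟩ := (hG3.sub_const_mul hX δ).exists_eq_of_le hG h hδ
  -- This is the coefficient of `G` in the linear equation, before pulling back; it is nonzero
  -- because `α ≠ 0`.
  have hne : algebraMap F L α * M.x + algebraMap F L (c ^ 2 + d - ε) ≠ 0 := by
    have := M.aeval_x_eq_zero (p := C α * X + C (c ^ 2 + d - ε))
    rw [map_add (aeval _), map_mul (aeval _), aeval_C, aeval_X, aeval_C] at this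
    rw [Ne, this]
    intro h0
    have h1 := congrArg (coeff · 1) h0
    simp only [coeff_add, coeff_C_mul, coeff_X_one, mul_one, coeff_C_succ, add_zero,
      coeff_zero] at h1
    exact hα0 h1
  refine ⟨(algebraMap F L γ * M.y + algebraMap F L (δ - c * α) * M.x +
    algebraMap F L (ζ - c * d)) / (algebraMap F L α * M.x + algebraMap F L (c ^ 2 + d - ε)), ?_⟩
  rw [map_div₀, eq_div_iff ((_root_.map_ne_zero _).mpr hne)]
  simp only [map_add, map_sub, map_mul, map_pow, AlgHom.commutes]
  linear_combination hεζ - (G + algebraMap F L c) * hcd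

/-- Induction on the pole order at the origin. Since `[n]` preserves `v`, each order at least `2` is
attained by the pullback of some `x ^ i` or `x ^ i * y`, a multiple of which is subtracted;
invariance carries the bound to all torsion points. -/
lemma exists_mulPull (hn : (n : F) ≠ 0) {G : L} (hG : M.IsTorsionInvariant n G) :
    ∃ u, G = M.mulPull n u := by
  obtain ⟨k, hk⟩ : ∃ k : ℕ, M.v G ≤ exp (k : ℤ) := by
    rcases M.v_eq_zero_or G with rfl | ⟨k, hk⟩
    · exact ⟨0, by simp⟩
    · exact ⟨k.toNat, by rw [hk, exp_le_exp]; exact k.self_le_toNat⟩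
  induction k generalizing G with
  | zero =>
    obtain ⟨c, rfl⟩ := hG.exists_const (by simpa using hk)
    exact ⟨algebraMap F L c, (AlgHom.commutes _ _).symm⟩
  | succ k ih =>
    rcases hk.lt_or_eq with h1 | h1
    · refine ih hG ?_
      rw [lt_exp_iff] at h1
      simpa using h1
    rcases Nat.eq_zero_or_pos k with rfl | hk0
    · exact hG.exists_mulPull_of_v_eq hn (by simpa using h1)
    obtain ⟨f, hf, hfv⟩ := M.exists_isAffineRegular_v (show 2 ≤ k + 1 by omega)
    have h2 : M.v (M.mulPull n f) = exp ((k + 1 : ℕ) : ℤ) := by rw [M.v_mulPull hn, hfv]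
    obtain ⟨c, hc⟩ := exists_sub_const_mul_lt (h1.trans h2.symm) (by
      intro h0; rw [h0, map_zero] at h2; exact exp_ne_zero h2.symm)
    rw [h2, lt_exp_iff] at hc
    obtain ⟨u, hu⟩ := ih (hG.sub_const_mul (mulPull hn hf) c) (by simpa using hc)
    refine ⟨u + algebraMap F L c * f, ?_⟩
    rw [map_add, ← hu, map_mul, AlgHom.commutes, sub_add_cancel]

end IsTorsionInvariant

end descent
end FunctionFieldModel

/-! ### The Weil pairing with a fixed point. -/

namespace FunctionFieldModel

open WeierstrassCurve WeierstrassCurve.Affine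

section weil

variable {K : Type u} [Field K] {E : WeierstrassCurve K} {F : Type v} {L : Type w} [Field F]
  [Field L] [Algebra K F] [Algebra F L] [Algebra K L] [IsScalarTower K F L]
  (M : FunctionFieldModel E F L) [E.IsElliptic] [DecidableEq F] [DecidableEq L] [IsAlgClosed F]
  {n : ℕ}

/-- The divisor `∑ ((P' + Q) - (Q))`, with `Q` ranging over the `n`-torsion points. -/
noncomputable def weilDiv (n : ℕ) (P' S : (E⁄F).Point) : ℤ :=
  (if n • (S - P') = 0 then 1 else 0) - (if n • S = 0 then 1 else 0)

lemma weilDiv_add {Q : (E⁄F).Point} (hQ : n • Q = 0) (P' S : (E⁄F).Point) :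
    weilDiv n P' (S + Q) = weilDiv n P' S := by
  rw [weilDiv, weilDiv, smul_sub, smul_sub, smul_add, hQ, add_zero]

/-- Each of the `n ^ 2` terms `(P' + Q) - (Q)` has the class of `P'`, so the total is the class of
`n ^ 2 • P' = 0`. -/
lemma weilDiv_mem (hn : (n : F) ≠ 0) {P' : (E⁄F).Point} (hP : n • n • P' = 0) :
    weilDiv n P' ∈ M.principal := by
  classical
  obtain ⟨s, hs, hcard⟩ := M.exists_torsion_finset (E := E) hn
  have h1 : weilDiv n P' =
      ∑ Q ∈ s, ((pointDiv (P' + Q) - pointDiv 0) - (pointDiv Q - pointDiv 0)) := by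
    ext S
    simp only [sub_sub_sub_cancel_right, Finset.sum_apply, Pi.sub_apply, Finset.sum_sub_distrib,
      pointDiv, weilDiv]
    congr 1
    · simp only [← sub_eq_iff_eq_add', Finset.sum_ite_eq, hs]
    · simp only [Finset.sum_ite_eq, hs]
  rw [← QuotientAddGroup.eq_zero_iff, h1, ← QuotientAddGroup.mk'_apply, map_sum]
  have h2 : ∀ Q ∈ s, QuotientAddGroup.mk' M.principal
      ((pointDiv (P' + Q) - pointDiv 0) - (pointDiv Q - pointDiv 0)) = M.clsHom P' := by
    intro Q _
    rw [map_sub]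
    change M.clsHom (P' + Q) - M.clsHom Q = _
    rw [map_add, add_sub_cancel_right]
  rw [Finset.sum_congr rfl h2, Finset.sum_const, hcard, ← map_nsmul, sq, mul_nsmul, hP, map_zero]

/-- A function with divisor `weilDiv n P'`. -/
structure IsWeilFunction (n : ℕ) (P' : (E⁄F).Point) (g : L) : Prop where
  ne_zero : g ≠ 0
  div_eq : M.div g = weilDiv n P'

namespace IsWeilFunction

variable {M} {P' : (E⁄F).Point} {g : L} (hg : M.IsWeilFunction n P' g)

include hg

lemma exists_tau_eq {Q : (E⁄F).Point} (hQ : n • Q = 0) :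
    ∃ c : F, c ≠ 0 ∧ M.tau Q g = algebraMap F L c * g :=
  M.exists_const_of_div_eq (by simpa using hg.ne_zero) hg.ne_zero <| by
    ext S
    rw [div_tau, hg.div_eq, weilDiv_add hQ]

/-- This is the alternating property `ψ P = 1`. The divisor of the product of the translates of `g`
by `i • P'`, `i < n`, telescopes to zero, so the product is constant; translating it by `P'`
replaces the factor `g` by `tau (n • P') g`. -/
lemma prod_tau_eq (hP : n • n • P' = 0) : M.tau (n • P') g = g := by
  set h := ∏ i ∈ Finset.range n, M.tau (i • P') g
  have h0 : h ≠ 0 := Finset.prod_ne_zero_iff.mpr fun i _ ↦ by simpa using hg.ne_zero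
  have hdiv (k : ℕ) (S : (E⁄F).Point) : M.div (∏ i ∈ Finset.range k, M.tau (i • P') g) S =
      (if n • (S - P') = 0 then 1 else 0) - (if n • (S - P' + k • P') = 0 then 1 else 0) := by
    induction k with
    | zero => rw [Finset.prod_range_zero, ← map_one (algebraMap F L), div_const]; simp
    | succ k ih =>
      rw [Finset.prod_range_succ, M.div_mul (Finset.prod_ne_zero_iff.mpr fun i _ ↦ by
        simpa using hg.ne_zero) (by simpa using hg.ne_zero), Pi.add_apply, ih, div_tau, hg.div_eq,
        weilDiv, succ_nsmul, ← add_assoc, add_right_comm _ _ P', sub_add_cancel, add_sub_right_comm]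
      ring
  obtain ⟨c, hc, hc'⟩ := M.exists_const_of_div h0 (fun S _ ↦ by
      rw [hdiv, smul_add, hP, add_zero, sub_self]) (by
      rw [hdiv, smul_add, hP, add_zero, sub_self]; norm_num)
  -- Both sides are the product of the translates for `0 ≤ i ≤ n`, with the first or the last factor
  -- split off.
  have h1 : M.tau P' h * g = h * M.tau (n • P') g := by
    rw [← Finset.prod_range_succ, Finset.prod_range_succ', zero_smul, tau_zero, AlgHom.id_apply,
      map_prod]
    simp only [tau_tau, succ_nsmul']
  rw [hc', AlgHom.commutes, ← hc'] at h1
  exact (mul_left_cancel₀ h0 h1).symm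

/-- Nondegeneracy: an invariant `g ^ d` descends to `u` with divisor `d((n • P') - (O))`, and
classes of points detect zero. -/
lemma nsmul_eq_zero (hn : (n : F) ≠ 0) {d : ℕ}
    (hd : ∀ Q : (E⁄F).Point, n • Q = 0 → M.tau Q (g ^ d) = g ^ d) : d • n • P' = 0 := by
  have h0 : 0 < n := Nat.pos_of_ne_zero (by rintro rfl; simp at hn)
  have hgd : g ^ d ≠ 0 := pow_ne_zero d hg.ne_zero
  have h1 : M.IsTorsionInvariant n (g ^ d) := by
    refine ⟨hd, fun S hS ↦ (M.v_tau_le_one_iff hgd S).mpr ?_⟩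
    rw [div_pow, hg.div_eq, Pi.smul_apply, weilDiv, if_neg hS, sub_zero]
    split_ifs <;> simp
  obtain ⟨u, hu⟩ := h1.exists_mulPull hn
  have hu0 : u ≠ 0 := by rintro rfl; rw [map_zero] at hu; exact hgd hu
  have h2 : M.div u = d • (pointDiv (n • P') - pointDiv 0) := by
    ext T
    obtain ⟨S, rfl⟩ := M.exists_nsmul_eq h0 T
    rw [div, ← M.v_mulPull hn, ← M.tau_mulPull h0, ← hu, ← div, div_pow, hg.div_eq]
    simp only [Pi.smul_apply, Pi.sub_apply, weilDiv, pointDiv, smul_sub, sub_eq_zero]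
  refine M.eq_zero_of_cls_eq_zero ?_
  change M.clsHom _ = 0
  rw [map_nsmul]
  change d • M.cls _ = 0
  rw [cls, ← QuotientAddGroup.mk_nsmul, QuotientAddGroup.eq_zero_iff]
  exact ⟨u, hu0, h2⟩

end IsWeilFunction

lemma tau_semilinear {σ : F ≃ₐ[K] F} {φ : L →ₐ[K] L} (hφ : Point.map φ M.gen = M.gen)
    (hc : ∀ c, φ (algebraMap F L c) = algebraMap F L (σ c)) (S : (E⁄F).Point) (f : L) :
    φ (M.tau S f) = M.tau (Point.map (σ : F →ₐ[K] F) S) (φ f) := by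
  have hconst : Point.map φ (M.const S) = M.const (Point.map (σ : F →ₐ[K] F) S) := by
    cases S with
    | zero => rw [← Point.zero_def, map_zero, map_zero, map_zero, map_zero]
    | some a b h =>
      obtain ⟨h', h''⟩ := M.const_some h
      rw [h'', Point.map_some, Point.map_some]
      obtain ⟨h₂, h₂'⟩ := M.const_some
        ((baseChange_nonsingular (W := E) (f := (σ : F →ₐ[K] F)) σ.injective ..).mpr h)
      refine Eq.trans ?_ h₂'.symm
      rw [Point.some.injEq]
      exact ⟨hc a, hc b⟩
  have h1 : Point.map φ (Point.map (M.tau S) M.gen) =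
      Point.map (M.tau (Point.map (σ : F →ₐ[K] F) S)) (Point.map φ M.gen) := by
    rw [hφ, map_tau_gen, map_tau_gen, map_add, hφ, hconst]
  rw [gen, Point.map_some, Point.map_some, Point.map_some, Point.map_some, Point.some.injEq] at h1
  refine DFunLike.congr_fun (M.ext_algHom (φ := φ.comp ((M.tau S).restrictScalars K))
    (ψ := ((M.tau (Point.map (σ : F →ₐ[K] F) S)).restrictScalars K).comp φ) h1.1 h1.2
    fun c ↦ ?_) f
  simp [hc]

lemma v_semilinear {σ : F ≃ₐ[K] F} {φ : L →ₐ[K] L} (hφ : Point.map φ M.gen = M.gen)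
    (hc : ∀ c, φ (algebraMap F L c) = algebraMap F L (σ c)) (f : L) : M.v (φ f) = M.v f := by
  have : (M.v.comap (φ : L →+* L)).IsTrivialOn F := ⟨fun c hc0 ↦ by
    change M.v (φ (algebraMap F L c)) = 1
    rw [hc]
    exact M.v_const (by simpa using hc0)⟩
  have h1 := M.val_eq_pow (w := M.v.comap (φ : L →+* L)) one_pos (by
    rw [gen, Point.map_some, Point.some.injEq] at hφ
    change M.v (φ M.x) = _
    rw [hφ.1, M.v_x]; rfl) f
  rw [pow_one] at h1
  exact h1

/-- `P'` itself need not be fixed by `σ`: the divisor depends on it only through `n • P'`. -/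
lemma IsWeilFunction.semilinear {P' : (E⁄F).Point} {g : L} (hg : M.IsWeilFunction n P' g)
    {σ : F ≃ₐ[K] F} {φ : L →ₐ[K] L} (hφ : Point.map φ M.gen = M.gen)
    (hc : ∀ c, φ (algebraMap F L c) = algebraMap F L (σ c))
    (hσ : Point.map (σ : F →ₐ[K] F) (n • P') = n • P') : M.IsWeilFunction n P' (φ g) := by
  refine ⟨by simpa using hg.ne_zero, ?_⟩
  ext S
  obtain ⟨S, rfl⟩ : ∃ T, Point.map (σ : F →ₐ[K] F) T = S :=
    ⟨Point.map (σ.symm : F →ₐ[K] F) S, by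
      cases S with
      | zero => rfl
      | some a b h =>
        rw [Point.map_some, Point.map_some, Point.some.injEq]
        exact ⟨σ.apply_symm_apply a, σ.apply_symm_apply b⟩⟩
  have h0 {T : (E⁄F).Point} : Point.map (σ : F →ₐ[K] F) T = 0 ↔ T = 0 :=
    map_eq_zero_iff _ (Point.map_injective _)
  have h1 : Point.map (σ : F →ₐ[K] F) (n • S) - n • P' = 0 ↔ n • S - n • P' = 0 := by
    conv_lhs => rw [← hσ, ← map_sub, h0]
  rw [div, ← M.tau_semilinear hφ hc, M.v_semilinear hφ hc, ← div, hg.div_eq, weilDiv, weilDiv,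
    smul_sub, smul_sub, ← map_nsmul]
  simp only [h0, h1]

include M in
theorem exists_weilPairing (hn : (n : F) ≠ 0) {P : (E⁄F).Point} (hP : n • P = 0) :
    ∃ ψ : (E⁄F).Point → F, (∀ Q, n • Q = 0 → ψ Q ≠ 0) ∧
      (∀ Q R, n • Q = 0 → n • R = 0 → ψ (Q + R) = ψ Q * ψ R) ∧ ψ P = 1 ∧
      (∀ d : ℕ, (∀ Q, n • Q = 0 → ψ Q ^ d = 1) → d • P = 0) ∧
      ∀ σ : F ≃ₐ[K] F, Point.map (W' := E) (σ : F →ₐ[K] F) P = P → ∀ Q, n • Q = 0 →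
        ψ (Point.map (W' := E) (σ : F →ₐ[K] F) Q) = σ (ψ Q) := by
  classical
  have h0 : 0 < n := Nat.pos_of_ne_zero (by rintro rfl; simp at hn)
  obtain ⟨P', rfl⟩ := M.exists_nsmul_eq h0 P
  obtain ⟨g, hg0, hg1⟩ := M.weilDiv_mem hn hP
  have hg : M.IsWeilFunction n P' g := ⟨hg0, hg1⟩
  -- `ψ Q` is the constant `tau Q g / g`; outside the torsion its values are arbitrary.
  choose! ψ hψ0 hψ using fun Q hQ ↦ hg.exists_tau_eq (Q := Q) hQ
  have hinj {a b : F} (h : algebraMap F L a * g = algebraMap F L b * g) : a = b :=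
    (algebraMap F L).injective (mul_right_cancel₀ hg0 h)
  refine ⟨ψ, hψ0, fun Q R hQ hR ↦ hinj ?_, hinj ?_, fun d hd ↦ hg.nsmul_eq_zero hn fun Q hQ ↦ ?_,
    fun σ hσ Q hQ ↦ ?_⟩
  · rw [← hψ _ (by rw [smul_add, hQ, hR, add_zero]), ← tau_tau, hψ R hR, map_mul, AlgHom.commutes,
      hψ Q hQ, map_mul]
    ring
  · rw [← hψ _ hP, hg.prod_tau_eq hP, map_one, one_mul]
  · rw [map_pow, hψ Q hQ, mul_pow, ← map_pow, hd Q hQ, map_one, one_mul]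
  -- `φ g` has the divisor of `g`, so `φ g = c g`. Applying `φ` to `tau Q g = ψ Q * g` and
  -- cancelling `c` gives equivariance.
  · obtain ⟨φ, hφ, hc⟩ := M.exists_semilinear σ
    have hgφ := hg.semilinear M hφ hc hσ
    obtain ⟨c, hc0, hcg⟩ := M.exists_const_of_div_eq hgφ.ne_zero hg0 (hgφ.div_eq.trans hg1.symm)
    have h1 := M.tau_semilinear hφ hc Q g
    rw [hψ Q hQ, map_mul, hc, hcg, map_mul, AlgHom.commutes,
      hψ _ (by rw [← map_nsmul, hQ, map_zero]), mul_left_comm] at h1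
    refine (hinj (mul_left_cancel₀ ?_ h1)).symm
    simpa using hc0

end weil
end FunctionFieldModel

/-! ### The structure of `E[N]` and the triangular basis. -/

namespace ModNGalois

open WeierstrassCurve WeierstrassCurve.Affine

section torsion

variable {K : Type u} [Field K] [DecidableEq (AlgebraicClosure K)] (E : WeierstrassCurve K)
  [E.IsElliptic] (N : ℕ) [NeZero N] [NeZero (N : K)]

lemma natCast_ne_zero {m : ℕ} (hm : m ∣ N) : (m : AlgebraicClosure K) ≠ 0 := by
  intro h
  obtain ⟨k, hk⟩ := hm
  have h1 : (N : K) = 0 := by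
    apply (algebraMap K (AlgebraicClosure K)).injective
    rw [map_natCast, map_zero, hk, Nat.cast_mul, h, zero_mul]
  exact NeZero.ne (N : K) h1

open Classical in
lemma exists_torsion_finset {m : ℕ} (hm : m ∣ N) :
    ∃ s : Finset (GeomPoint E), (∀ S, S ∈ s ↔ m • S = 0) ∧ s.card = m ^ 2 :=
  (FunctionField.model E (AlgebraicClosure K)).exists_torsion_finset (natCast_ne_zero N hm)

lemma mem_torsion {N : ℕ} {S : GeomPoint E} : S ∈ Torsion E N ↔ N • S = 0 :=
  AddSubgroup.torsionBy.nsmul_iff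

instance finite_torsion : Finite (Torsion E N) := by
  obtain ⟨s, hs, -⟩ := exists_torsion_finset E N dvd_rfl
  exact Set.Finite.subset s.finite_toSet fun S hS ↦ (hs S).mpr ((mem_torsion E).mp hS)

lemma card_torsion : Nat.card (Torsion E N) = N ^ 2 := by
  obtain ⟨s, hs, hcard⟩ := exists_torsion_finset E N dvd_rfl
  rw [← hcard]
  exact Nat.subtype_card s fun S ↦ (hs S).trans (mem_torsion E).symm

/-- If `m ∣ N` is the exponent of `E[N]`, all `N ^ 2` points lie in `E[m]`, which has `m ^ 2`
elements; so `m = N`. -/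
lemma exists_addOrderOf_eq : ∃ P : Torsion E N, addOrderOf P = N := by
  obtain ⟨P, hP⟩ := AddMonoid.exists_addOrderOf_eq_exponent
    (AddMonoid.ExponentExists.of_finite (G := Torsion E N))
  refine ⟨P, ?_⟩
  have h1 : addOrderOf P ∣ N := addOrderOf_dvd_iff_nsmul_eq_zero.mpr
    (AddSubgroup.torsionBy.nsmul P)
  obtain ⟨s, hs, hcard⟩ := exists_torsion_finset E N h1
  have h2 : N ^ 2 ≤ addOrderOf P ^ 2 := by
    rw [← card_torsion E N, ← hcard, ← Nat.card_eq_finsetCard]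
    refine Nat.card_le_card_of_injective (fun S : Torsion E N ↦ (⟨S, (hs S).mpr ?_⟩ : s))
      fun S T h ↦ Subtype.ext (congrArg (fun x : s ↦ (x : GeomPoint E)) h)
    rw [hP]
    have := AddMonoid.exponent_nsmul_eq_zero S
    exact congrArg Subtype.val this
  exact le_antisymm (Nat.le_of_dvd (Nat.pos_of_neZero N) h1)
    ((Nat.pow_le_pow_iff_left two_ne_zero).mp h2)

lemma exists_weil (P : Torsion E N) : ∃ ψ : Multiplicative (Torsion E N) →* (AlgebraicClosure K)ˣ,
    ψ (.ofAdd P) = 1 ∧ (∀ d : ℕ, (∀ Q, ψ Q ^ d = 1) → d • P = 0) ∧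
    ∀ σ : Gal(AlgebraicClosure K/K), galoisAddHom E N σ P = P → ∀ Q : Torsion E N,
      (ψ (.ofAdd (galoisAddHom E N σ Q)) : AlgebraicClosure K) = σ (ψ (.ofAdd Q)) := by
  classical
  obtain ⟨ψ, h0, hadd, h1, hd, hσ⟩ := (FunctionField.model E (AlgebraicClosure K)).exists_weilPairing
    (natCast_ne_zero N dvd_rfl) ((mem_torsion E).mp P.2)
  have hT (Q : Torsion E N) : N • (Q : GeomPoint E) = 0 := (mem_torsion E).mp Q.2
  refine ⟨MonoidHom.mk' (fun Q ↦ Units.mk0 (ψ (Q.toAdd : Torsion E N)) (h0 _ (hT _))) fun Q R ↦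
    Units.ext (hadd _ _ (hT _) (hT _)), Units.ext h1, fun d h ↦ Subtype.ext ?_, fun σ hP Q ↦ ?_⟩
  · refine hd d fun Q hQ ↦ ?_
    exact congrArg Units.val (h (.ofAdd ⟨Q, (mem_torsion E).mpr hQ⟩))
  · exact hσ σ (congrArg Subtype.val hP) Q (hT Q)

variable {E N}

lemma val_nsmul (c : ZMod N) (P : Torsion E N) : c.val • P = c • P := by
  rw [← Nat.cast_smul_eq_nsmul (ZMod N), ZMod.natCast_zmod_val]

/-- The image of `ψ` is a finite abelian group, so one value has order equal to its exponent; by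
nondegeneracy this exponent kills `P`, hence is a multiple of `N`. -/
lemma exists_orderOf_weil {P : Torsion E N} (hP : addOrderOf P = N)
    {ψ : Multiplicative (Torsion E N) →* (AlgebraicClosure K)ˣ}
    (hψ : ∀ d : ℕ, (∀ Q, ψ Q ^ d = 1) → d • P = 0) :
    ∃ Q : Torsion E N, orderOf (ψ (.ofAdd Q)) = N := by
  have : Finite ψ.range := Finite.of_surjective ψ.rangeRestrict ψ.rangeRestrict_surjective
  obtain ⟨⟨z, hz⟩, hQ⟩ := Monoid.exists_orderOf_eq_exponent
    (Monoid.ExponentExists.of_finite (G := ψ.range))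
  rw [Subgroup.orderOf_mk] at hQ
  obtain ⟨Q, rfl⟩ := hz
  refine ⟨Q.toAdd, Nat.dvd_antisymm ?_ ?_⟩
  · rw [orderOf_dvd_iff_pow_eq_one, ← map_pow, ← ofAdd_nsmul, AddSubgroup.torsionBy.nsmul,
      ofAdd_zero, map_one]
  · conv_lhs => rw [← hP]
    rw [addOrderOf_dvd_iff_nsmul_eq_zero]
    refine hψ _ fun R ↦ ?_
    change ψ R ^ orderOf (ψ Q) = 1
    rw [hQ]
    exact congrArg Subtype.val (Monoid.pow_exponent_eq_one (⟨ψ R, R, rfl⟩ : ψ.range))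

lemma weil_apply {P Q : Torsion E N} {ψ : Multiplicative (Torsion E N) →* (AlgebraicClosure K)ˣ}
    (hP : ψ (.ofAdd P) = 1) (i j : ZMod N) :
    ψ (.ofAdd (i • P + j • Q)) = ψ (.ofAdd Q) ^ j.val := by
  rw [ofAdd_add, map_mul, ← val_nsmul, ← val_nsmul, ofAdd_nsmul, ofAdd_nsmul, map_pow, map_pow, hP,
    one_pow, one_mul]

/-- Applying `ψ` to a relation `i P + j Q = 0` removes `P` and leaves `ψ Q ^ j = 1`. -/
lemma linearIndependent_weil {P Q : Torsion E N} (hP : addOrderOf P = N)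
    {ψ : Multiplicative (Torsion E N) →* (AlgebraicClosure K)ˣ} (hψP : ψ (.ofAdd P) = 1)
    (hQ : orderOf (ψ (.ofAdd Q)) = N) : LinearIndependent (ZMod N) ![P, Q] := by
  rw [LinearIndependent.pair_iff]
  intro i j h
  have h1 := weil_apply (Q := Q) hψP i j
  rw [h, ofAdd_zero, map_one] at h1
  have hj : j = 0 := by
    rw [← ZMod.val_eq_zero]
    refine Nat.eq_zero_of_dvd_of_lt ?_ j.val_lt
    conv_lhs => rw [← hQ]
    exact orderOf_dvd_of_pow_eq_one h1.symm
  refine ⟨?_, hj⟩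
  rw [hj, zero_smul, add_zero, ← val_nsmul] at h
  rw [← ZMod.val_eq_zero]
  refine Nat.eq_zero_of_dvd_of_lt ?_ i.val_lt
  conv_lhs => rw [← hP]
  exact addOrderOf_dvd_of_nsmul_eq_zero h

lemma exists_basis {P Q : Torsion E N} (h : LinearIndependent (ZMod N) ![P, Q]) :
    ∃ b : Module.Basis (Fin 2) (ZMod N) (Torsion E N), b 0 = P ∧ b 1 = Q := by
  have h1 : Function.Bijective (Fintype.linearCombination (ZMod N) ![P, Q]) := by
    refine (Nat.bijective_iff_injective_and_card _).mpr
      ⟨(LinearIndependent.fintypeLinearCombination_injective h), ?_⟩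
    rw [card_torsion E N, Nat.card_fun, Nat.card_zmod, Nat.card_fin]
  have h2 : ⊤ ≤ Submodule.span (ZMod N) (Set.range ![P, Q]) := by
    rw [← Fintype.range_linearCombination, LinearMap.range_eq_top.mpr h1.2]
  exact ⟨Module.Basis.mk h h2, by simp, by simp⟩

variable (E N) in
lemma nonempty_basis : Nonempty (Module.Basis (Fin 2) (ZMod N) (Torsion E N)) := by
  obtain ⟨P, hP⟩ := exists_addOrderOf_eq E N
  obtain ⟨ψ, h1, h2, -⟩ := exists_weil E N P
  obtain ⟨Q, hQ⟩ := exists_orderOf_weil hP h2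
  exact ⟨(exists_basis (linearIndependent_weil hP h1 hQ)).choose⟩

lemma coe_matrixRep (b : Module.Basis (Fin 2) (ZMod N) (Torsion E N))
    (σ : Gal(AlgebraicClosure K/K)) :
    (matrixRep E N b σ : Matrix (Fin 2) (Fin 2) (ZMod N)) =
      LinearMap.toMatrix b b (galoisEnd E N σ) := rfl

lemma exists_conj_matrixRep (b b' : Module.Basis (Fin 2) (ZMod N) (Torsion E N)) :
    ∃ g : GL (Fin 2) (ZMod N), ∀ σ, g * matrixRep E N b σ * g⁻¹ = matrixRep E N b' σ := by
  refine ⟨⟨b'.toMatrix b, b.toMatrix b', b'.toMatrix_mul_toMatrix_flip b,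
    b.toMatrix_mul_toMatrix_flip b'⟩, fun σ ↦ Units.ext ?_⟩
  exact basis_toMatrix_mul_linearMap_toMatrix_mul_basis_toMatrix ..

lemma cyclotomicChar_spec (σ : Gal(AlgebraicClosure K/K)) {t : (AlgebraicClosure K)ˣ}
    (ht : t ^ N = 1) :
    σ (t : AlgebraicClosure K) = (t ^ (cyclotomicChar K N σ : ZMod N).val : (AlgebraicClosure K)ˣ) := by
  have := modularCyclotomicCharacter.spec (AlgebraicClosure K)
    (HasEnoughRootsOfUnity.natCard_rootsOfUnity (AlgebraicClosure K) N)
    (MulSemiringAction.toRingAut Gal(AlgebraicClosure K/K) (AlgebraicClosure K) σ)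
    ((mem_rootsOfUnity N t).mpr ht)
  rw [Units.val_pow_eq_pow_val]
  exact this

/-- If a point of exact order `N` is fixed by Galois, it is part of a basis in which the Galois
representation is triangular with diagonal `1, χ_N`. -/
lemma exists_basis_matrixRep_eq {P : Torsion E N} (hP : addOrderOf P = N)
    (hσ : ∀ σ, galoisAddHom E N σ P = P) :
    ∃ (b : Module.Basis (Fin 2) (ZMod N) (Torsion E N)) (β : Gal(AlgebraicClosure K/K) → ZMod N),
      ∀ σ, (matrixRep E N b σ : Matrix (Fin 2) (Fin 2) (ZMod N)) =
        !![1, β σ; 0, (cyclotomicChar K N σ : ZMod N)] := by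
  obtain ⟨ψ, h1, h2, h3⟩ := exists_weil E N P
  obtain ⟨Q, hQ⟩ := exists_orderOf_weil hP h2
  obtain ⟨b, hb0, hb1⟩ := exists_basis (linearIndependent_weil hP h1 hQ)
  refine ⟨b, fun σ ↦ b.repr (galoisAddHom E N σ Q) 0, fun σ ↦ ?_⟩
  -- Both sides are exponents for `σ (ψ Q)`: one from expanding `σ Q` in the basis and using `ψ P =
  -- 1`, the other from the cyclotomic character. They agree because `ψ Q` has order `N`.
  have hδ : b.repr (galoisAddHom E N σ Q) 1 = (cyclotomicChar K N σ : ZMod N) := by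
    have h4 := h3 σ (hσ σ) Q
    rw [← b.sum_repr (galoisAddHom E N σ Q), Fin.sum_univ_two, hb0, hb1, weil_apply h1,
      cyclotomicChar_spec σ (hQ ▸ pow_orderOf_eq_one _), Units.val_inj,
      pow_inj_mod, hQ, Nat.mod_eq_of_lt (ZMod.val_lt _), Nat.mod_eq_of_lt (ZMod.val_lt _)] at h4
    exact ZMod.val_injective N h4
  have hP' : b.repr (galoisAddHom E N σ P) = Finsupp.single 0 1 := by
    rw [hσ, ← hb0, b.repr_self]
  rw [coe_matrixRep]
  ext i j
  rw [LinearMap.toMatrix_apply]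
  fin_cases j
  · change b.repr (galoisAddHom E N σ (b 0)) i = _
    rw [hb0, hP']
    fin_cases i <;> simp
  · change b.repr (galoisAddHom E N σ (b 1)) i = _
    rw [hb1]
    fin_cases i
    · simp
    · simpa using hδ

end torsion
end ModNGalois

/-! ### Rational points and Galois-fixed torsion points. -/

namespace ModNGalois

open WeierstrassCurve WeierstrassCurve.Affine

section rational

variable {K : Type u} [Field K] [DecidableEq K] [DecidableEq (AlgebraicClosure K)]
  {E : WeierstrassCurve K} [E.IsElliptic] {N : ℕ} [NeZero N] [NeZero (N : K)]

/-- The base change of `E` to `K` equals `E` only propositionally; a variable curve `V` allows the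
transport of points. -/
lemma exists_addOrderOf_baseChange_iff (V : Affine K) (hV : V = E.toAffine) :
    (∃ P : V.Point, addOrderOf P = N) ↔ ∃ P : E.toAffine.Point, addOrderOf P = N := by
  subst hV; rfl

lemma baseChange_self : (E⁄K) = E.toAffine := E.map_id

lemma coe_galoisAddHom (σ : Gal(AlgebraicClosure K/K)) (P : Torsion E N) :
    (galoisAddHom E N σ P : GeomPoint E) = Point.map (W' := E) (σ : AlgebraicClosure K →ₐ[K] AlgebraicClosure K) P := rfl

lemma exists_fixed_of_rational (h : ∃ P : E.toAffine.Point, addOrderOf P = N) :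
    ∃ P : Torsion E N, addOrderOf P = N ∧ ∀ σ, galoisAddHom E N σ P = P := by
  rw [← exists_addOrderOf_baseChange_iff _ baseChange_self] at h
  obtain ⟨P, hP⟩ := h
  have h1 : addOrderOf (Point.baseChange (W' := E) K (AlgebraicClosure K) P) = N := by
    rw [addOrderOf_injective _ (Point.map_injective _), hP]
  refine ⟨⟨Point.baseChange (W' := E) K (AlgebraicClosure K) P, (mem_torsion E).mpr ?_⟩, ?_,
    fun σ ↦ Subtype.ext ?_⟩
  · conv_lhs => rw [← h1, addOrderOf_nsmul_eq_zero]
  · rw [← AddSubgroup.addOrderOf_coe, h1]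
  · exact Point.map_baseChange (W' := E) _ P

/-- Over a perfect field the algebraic closure is Galois, so fixed coordinates lie in `K`. -/
lemma rational_of_exists_fixed [PerfectField K] {P : Torsion E N} (hP : addOrderOf P = N)
    (hσ : ∀ σ, galoisAddHom E N σ P = P) : ∃ P : E.toAffine.Point, addOrderOf P = N := by
  rw [← exists_addOrderOf_baseChange_iff _ baseChange_self]
  suffices ∃ Q : (E⁄K).Point, Point.baseChange (W' := E) K (AlgebraicClosure K) Q = P by
    obtain ⟨Q, hQ⟩ := this
    have h1 := addOrderOf_injective (Point.baseChange (W' := E) K (AlgebraicClosure K))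
      (Point.map_injective _) Q
    exact ⟨Q, by rw [← h1, hQ, AddSubgroup.addOrderOf_coe, hP]⟩
  have h1 (σ) := congrArg Subtype.val (hσ σ)
  simp only [coe_galoisAddHom] at h1
  obtain ⟨P, hP'⟩ := P
  cases P with
  | zero => exact ⟨0, map_zero _⟩
  | some a b h =>
    simp only [Point.map_some, Point.some.injEq] at h1
    obtain ⟨x, rfl⟩ := (InfiniteGalois.mem_range_algebraMap_iff_fixed (k := K) a).mpr
      fun σ ↦ (h1 σ).1
    obtain ⟨y, rfl⟩ := (InfiniteGalois.mem_range_algebraMap_iff_fixed (k := K) b).mpr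
      fun σ ↦ (h1 σ).2
    have hxy : (E⁄K).Nonsingular x y := (baseChange_nonsingular (W := E)
      (f := Algebra.ofId K (AlgebraicClosure K)) (algebraMap K _).injective x y).mp h
    exact ⟨.some x y hxy, rfl⟩

/-- Matrices in `B1 N` fix `e₁ = (1, 0)`, so the point with coordinates `g⁻¹ e₁` is fixed; its order
is that of `e₁`, namely `N`. -/
lemma exists_fixed_of_conj {b : Module.Basis (Fin 2) (ZMod N) (Torsion E N)}
    {g : GL (Fin 2) (ZMod N)} (h : ∀ σ, g * matrixRep E N b σ * g⁻¹ ∈ B1 N) :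
    ∃ P : Torsion E N, addOrderOf P = N ∧ ∀ σ, galoisAddHom E N σ P = P := by
  set e : Fin 2 → ZMod N := ![1, 0] with he
  set w : Fin 2 → ZMod N := (g⁻¹ : GL (Fin 2) (ZMod N)).val.mulVec e with hw
  have hgw : g.val.mulVec w = e := by
    rw [hw, Matrix.mulVec_mulVec, ← Units.val_mul, mul_inv_cancel, Units.val_one, Matrix.one_mulVec]
  refine ⟨b.equivFun.symm w, ?_, fun σ ↦ ?_⟩
  · refine Nat.dvd_antisymm (addOrderOf_dvd_of_nsmul_eq_zero (AddSubgroup.torsionBy.nsmul _)) ?_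
    have h1 := addOrderOf_nsmul_eq_zero (b.equivFun.symm w)
    rw [← map_nsmul, LinearEquiv.map_eq_zero_iff] at h1
    have h2 := congrArg (fun u ↦ g.val.mulVec u 0) h1
    simp only [Matrix.mulVec_smul, hgw, Matrix.mulVec_zero] at h2
    rw [← ZMod.natCast_eq_zero_iff]
    simpa [he] using h2
  · obtain ⟨β, d, hB⟩ := h σ
    have h1 : (matrixRep E N b σ).val.mulVec w = w := by
      have h2 : (matrixRep E N b σ) * g⁻¹ = g⁻¹ * (g * matrixRep E N b σ * g⁻¹) := by group
      rw [hw, Matrix.mulVec_mulVec, ← Units.val_mul, h2, Units.val_mul, ← Matrix.mulVec_mulVec, hB]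
      congr 1
      ext i
      fin_cases i <;> simp [he, Matrix.mulVec, dotProduct, Fin.sum_univ_two]
    apply b.equivFun.injective
    rw [LinearEquiv.apply_symm_apply]
    conv_rhs => rw [← h1, coe_matrixRep]
    have h3 := LinearMap.toMatrix_mulVec_repr b b (galoisEnd E N σ) (b.equivFun.symm w)
    rw [← b.equivFun_apply, LinearEquiv.apply_symm_apply] at h3
    rw [h3]
    rfl

end rational

end ModNGalois

theorem mainTheorem7 {K : Type*} [Field K] [PerfectField K]
    [DecidableEq K] [DecidableEq (AlgebraicClosure K)]
    (E : WeierstrassCurve K) [E.IsElliptic] (N : ℕ) [NeZero N] [NeZero (N : K)] :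
    Nonempty (Module.Basis (Fin 2) (ZMod N) (ModNGalois.Torsion E N)) ∧
    ∀ b : Module.Basis (Fin 2) (ZMod N) (ModNGalois.Torsion E N),
      List.TFAE [
        ∃ P : E.toAffine.Point, addOrderOf P = N,
        ∃ (g : GL (Fin 2) (ZMod N)) (β : Gal(AlgebraicClosure K/K) → ZMod N),
          ∀ σ : Gal(AlgebraicClosure K/K),
            ((g * ModNGalois.matrixRep E N b σ * g⁻¹ : GL (Fin 2) (ZMod N)) :
                Matrix (Fin 2) (Fin 2) (ZMod N)) =
              !![1, β σ; 0, (ModNGalois.cyclotomicChar K N σ : ZMod N)],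
        ∃ g : GL (Fin 2) (ZMod N),
          (ModNGalois.matrixRep E N b).range.map (MulAut.conj g).toMonoidHom ≤
            ModNGalois.B1 N] := by
  refine ⟨ModNGalois.nonempty_basis E N, fun b ↦ ?_⟩
  tfae_have 1 → 2 := by
    intro h
    obtain ⟨P, hP, hσ⟩ := ModNGalois.exists_fixed_of_rational h
    obtain ⟨b', β, hb'⟩ := ModNGalois.exists_basis_matrixRep_eq hP hσ
    obtain ⟨g, hg⟩ := ModNGalois.exists_conj_matrixRep b b'
    exact ⟨g, β, fun σ ↦ by rw [hg, hb']⟩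
  tfae_have 2 → 3 := by
    rintro ⟨g, β, h⟩
    refine ⟨g, ?_⟩
    rintro _ ⟨_, ⟨σ, rfl⟩, rfl⟩
    exact ⟨β σ, ModNGalois.cyclotomicChar K N σ, h σ⟩
  tfae_have 3 → 1 := by
    rintro ⟨g, h⟩
    obtain ⟨P, hP, hσ⟩ := ModNGalois.exists_fixed_of_conj (b := b) (g := g)
      fun σ ↦ h ⟨_, ⟨σ, rfl⟩, rfl⟩
    exact ModNGalois.rational_of_exists_fixed hP hσ
  tfae_finish
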